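/- Let $G$ be a compact group, let $A,B,C$ be finite-dimensional quantum systems with $d_X=\dim\mathcal H_X$, and let $g\mapsto V_g$ and $g\mapsto U_g$ be continuous unitary representations of $G$ on $\mathcal H_B$ and $\mathcal H_C$. Let $A'$ be a copy of $C$ (so $d_{A'}=d_C$), let $|\phi_+^{A'C}\rangle=d_C^{-1/2}\sum_i|i\rangle|i\rangle$, let $\overline U_g$ be the complex conjugate of $U_g$ in the basis $\{|i\rangle\}$, acting on $A'$, and let $\mathcal G$ be the bipartite twirl $$\mathcal G[X]=\int_G dg\,(\overline U_g\otimes W_g)\,X\,(\overline U_g\otimes W_g)^\dagger ,$$ where $dg$ is the normalized Haar measure, with $W_g=V_g$ for operators $X$ on $A'B$ and $W_g=U_g$ for operators on $A'C$. A CPTP map $\mathcal E:\mathcal B(\mathcal H_B)\to\mathcal B(\mathcal H_C)$ is $G$-covariant if $U_g\mathcal E(X)U_g^\dagger=\mathcal E(V_gXV_g^\dagger)$ for all $g$ and $X$. The conditional min-entropy is $H_{\min}(A|B)_\Omega=-\log_2\inf\{\mathrm{Tr}\,\tau^B:\tau^B\ge 0,\ \mathbb 1^A\otimes\tau^B\ge\Omega^{AB}\}$.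 (I) Let $\rho^{AB}$ and $\sigma^{AC}$ be states with $\mathrm{Tr}_B\,\rho^{AB}=\mathrm{Tr}_C\,\sigma^{AC}$. Fix an arbitrary informationally complete POVM $\{M_j\}_{j=1}^{d_A^2}$ on $A$ (its elements span $\mathcal B(\mathcal H_A)$). The following are equivalent: 1. There is a $G$-covariant CPTP map $\mathcal E:\mathcal B(\mathcal H_B)\to\mathcal B(\mathcal H_C)$ with $\sigma^{AC}=(\mathrm{id}\otimes\mathcal E)(\rho^{AB})$. 2. For every CPTP map $\Phi:\mathcal B(\mathcal H_A)\to\mathcal B(\mathcal H_{A'})$, $$H_{\min}(A'|B)_{\mathcal G[(\Phi\otimes\mathrm{id})(\rho^{AB})]}\le H_{\min}(A'|C)_{\mathcal G[(\Phi\otimes\mathrm{id})(\sigma^{AC})]}.$$ 3. The inequality in 2 holds for every measure-and-prepare channel $\Phi(\eta)=\sum_{j=1}^{d_A^2}\mathrm{Tr}[M_j\eta]\,\omega_j$ built on the fixed POVM $\{M_j\}$, where the states $\omega_j$ on $A'$ vary freely. 4. For every $\Phi$ as in 3, $$2^{-H_{\min}(A'|B)_{\mathcal G[(\Phi\otimes\mathrm{id})(\rho^{AB})]}}\ge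 d_C\,\langle\phi_+^{A'C}|\,\mathcal G[(\Phi\otimes\mathrm{id})(\sigma^{AC})]\,|\phi_+^{A'C}\rangle .$$ (The equivalence of 1 and 2 does not refer to the POVM.) (II) For states $\rho^B$ and $\sigma^C$, there is a $G$-covariant CPTP map $\mathcal E$ with $\mathcal E(\rho^B)=\sigma^C$ if and only if for every state $\eta^{A'}$ $$H_{\min}(A'|B)_{\mathcal G[\eta^{A'}\otimes\rho^B]}\le H_{\min}(A'|C)_{\mathcal G[\eta^{A'}\otimes\sigma^C]} .$$ -/

import Mathlib

open scoped Matrix Kronecker ComplexOrder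

noncomputable section

/-- A (density-matrix) state on the finite-dimensional Hilbert space `ℂ^s`. -/
def IsState {s : Type*} [Fintype s] (ρ : Matrix s s ℂ) : Prop :=
  ρ.PosSemidef ∧ ρ.trace = 1

/-- The action `id ⊗ E` on the second tensor factor: `E` is applied to every block
`(⟨i| ⊗ 1) X (|j⟩ ⊗ 1)` of `X`. -/
def idTensor {r s t : Type*} (E : Matrix s s ℂ →ₗ[ℂ] Matrix t t ℂ)
    (X : Matrix (r × s) (r × s) ℂ) : Matrix (r × t) (r × t) ℂ :=
  Matrix.of fun p q => E (Matrix.of fun x y => X (p.1, x) (q.1, y)) p.2 q.2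

/-- The action `Φ ⊗ id` on the first tensor factor. -/
def tensorId {r s t : Type*} (Φ : Matrix r r ℂ →ₗ[ℂ] Matrix t t ℂ)
    (X : Matrix (r × s) (r × s) ℂ) : Matrix (t × s) (t × s) ℂ :=
  Matrix.of fun p q => Φ (Matrix.of fun i j => X (i, p.2) (j, q.2)) p.1 q.1

/-- Completely positive, trace-preserving linear maps. -/
structure IsCPTP {s t : Type*} [Fintype s] [Fintype t]
    (E : Matrix s s ℂ →ₗ[ℂ] Matrix t t ℂ) : Prop where
  completelyPositive : ∀ (k : ℕ) (X : Matrix (Fin k × s) (Fin k × s) ℂ),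
    X.PosSemidef → (idTensor E X).PosSemidef
  tracePreserving : ∀ X : Matrix s s ℂ, (E X).trace = X.trace

/-- The marginal on the first factor, `Tr₂ X`. -/
def marginalFst {r s : Type*} [Fintype s] (X : Matrix (r × s) (r × s) ℂ) : Matrix r r ℂ :=
  Matrix.of fun i j => ∑ x, X (i, x) (j, x)

/-- The conditional min-entropy `H_min(A|B)_Ω`, with logarithm to base `2`; the first index factor
of `Ω` is `A` and the second is `B`. -/
def condMinEntropy {r s : Type*} [Fintype r] [DecidableEq r] [Fintype s]
    (Ω : Matrix (r × s) (r × s) ℂ) : ℝ :=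
  -Real.logb 2 (sInf {x : ℝ | ∃ τ : Matrix s s ℂ, τ.PosSemidef ∧
    ((1 : Matrix r r ℂ) ⊗ₖ τ - Ω).PosSemidef ∧ x = τ.trace.re})

/-- An informationally complete POVM on `ℂ^r` with `(dim)^2` elements. -/
structure IsInfoCompletePOVM {r : Type*} [Fintype r] [DecidableEq r]
    (M : Fin (Fintype.card r ^ 2) → Matrix r r ℂ) : Prop where
  posSemidef : ∀ j, (M j).PosSemidef
  sum_eq_one : ∑ j, M j = 1
  span_eq_top : Submodule.span ℂ (Set.range M) = ⊤

/-- The measure-and-prepare map `η ↦ ∑ⱼ Tr[Mⱼ η] ωⱼ`. -/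
def measurePrepare {ι r t : Type*} [Fintype ι] [Fintype r]
    (M : ι → Matrix r r ℂ) (ω : ι → Matrix t t ℂ) : Matrix r r ℂ →ₗ[ℂ] Matrix t t ℂ where
  toFun η := ∑ j, (M j * η).trace • ω j
  map_add' x y := by
    simp [mul_add, add_smul, Finset.sum_add_distrib]
  map_smul' z x := by
    simp [Finset.smul_sum, smul_smul]

/-- The maximally entangled vector `d^{-1/2} ∑ᵢ |i⟩|i⟩` in `ℂ^t ⊗ ℂ^t`. -/
def maxEntangled (t : Type*) [Fintype t] [DecidableEq t] : t × t → ℂ :=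
  fun p => if p.1 = p.2 then ((1 / Real.sqrt (Fintype.card t) : ℝ) : ℂ) else 0

/-- The (real part of the, for Hermitian `X` real) expectation value `⟨φ| X |φ⟩`. -/
def expectation {n : Type*} [Fintype n] (φ : n → ℂ) (X : Matrix n n ℂ) : ℝ :=
  (star φ ⬝ᵥ (X *ᵥ φ)).re

section Group

variable {G : Type*} [Group G]

/-- Covariance of `E` with respect to the representation `V` on its input and `U` on its output. -/
def IsCovariant {s t : Type*} [Fintype s] [DecidableEq s] [Fintype t] [DecidableEq t]
    (V : G →* Matrix.unitaryGroup s ℂ) (U : G →* Matrix.unitaryGroup t ℂ)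
    (E : Matrix s s ℂ →ₗ[ℂ] Matrix t t ℂ) : Prop :=
  ∀ (g : G) (X : Matrix s s ℂ),
    (U g : Matrix t t ℂ) * E X * (U g : Matrix t t ℂ)ᴴ
      = E ((V g : Matrix s s ℂ) * X * (V g : Matrix s s ℂ)ᴴ)

/-- `σ = (id ⊗ E)(ρ)` for some covariant CPTP map `E`. -/
def CovariantMajorizes {r s t : Type*} [Fintype s] [DecidableEq s] [Fintype t] [DecidableEq t]
    (V : G →* Matrix.unitaryGroup s ℂ) (U : G →* Matrix.unitaryGroup t ℂ)
    (ρ : Matrix (r × s) (r × s) ℂ) (σ : Matrix (r × t) (r × t) ℂ) : Prop :=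
  ∃ E : Matrix s s ℂ →ₗ[ℂ] Matrix t t ℂ, IsCPTP E ∧ IsCovariant V U E ∧ σ = idTensor E ρ

/-- The operator `Ū_g ⊗ V_g`, the bar being entrywise complex conjugation. -/
def conjKron {s t : Type*} [Fintype s] [DecidableEq s] [Fintype t] [DecidableEq t]
    (U : G →* Matrix.unitaryGroup t ℂ) (V : G →* Matrix.unitaryGroup s ℂ) (g : G) :
    Matrix (t × s) (t × s) ℂ :=
  ((U g : Matrix t t ℂ).map star) ⊗ₖ (V g : Matrix s s ℂ)

/-- The bipartite twirl `∫ dg (Ū_g ⊗ V_g) X (Ū_g ⊗ V_g)†` over the compact group `G`, taken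
entrywise, with respect to the normalized Haar measure. -/
def twirl [TopologicalSpace G] [IsTopologicalGroup G] [CompactSpace G]
    [MeasurableSpace G] [BorelSpace G]
    {s t : Type*} [Fintype s] [DecidableEq s] [Fintype t] [DecidableEq t]
    (U : G →* Matrix.unitaryGroup t ℂ) (V : G →* Matrix.unitaryGroup s ℂ)
    (X : Matrix (t × s) (t × s) ℂ) : Matrix (t × s) (t × s) ℂ :=
  Matrix.of fun p q => ∫ g, (conjKron U V g * X * (conjKron U V g)ᴴ) p q
    ∂(MeasureTheory.Measure.haarMeasure (⊤ : TopologicalSpace.PositiveCompacts G))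

end Group

end

/-! A covariant channel commutes with the twirl and sends a feasible `τ` for the min-entropy program
to a feasible `E τ` of equal trace, so it cannot decrease the min-entropy
(`IsCovariant.condMinEntropy_twirl_le`). Since `d_C ⟨φ₊|1 ⊗ τ|φ₊⟩ = Tr τ`, the scaled singlet
fraction of a state is at most every feasible value, and the entropy inequality therefore implies
the singlet-fraction inequality.

The converse is a duality argument. Conditioning on an informationally complete POVM turns `(id ⊗ E)
ρ = σ` into the finitely many equations `E ρ_k = σ_k`. Invariant positive operators of trace `d_B`
form a compact convex set, and a covariant channel solving the equations exists as soon as a linear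
image of this set contains `(1, σ)`. If no channel exists, Hahn-Banach
(`exists_separating_operators`) yields `τ` and Hermitian `Y_k` such that `1 ⊗ τ - ∑ Y_k ⊗ ρ_k` has a
positive twirl, while `Tr τ < ∑ Tr(Y_kᵀ σ_k)`.

As `Tr ρ_k = Tr σ_k`, shifting each `Y_k` by a multiple of the identity and rescaling all of them
preserves both properties, so the `Y_k` may be taken to be states `ω_k`. The twirl of `1 ⊗ τ` is
again of the form `1 ⊗ τ'`, so `τ'` is feasible for the twirl of `∑ ω_k ⊗ ρ_k`, the image of `ρ`
under a measure-and-prepare channel. Its trace lies strictly below `∑ Tr(ω_kᵀ σ_k)`, which is `d_C`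
times the singlet fraction on the `σ` side because `φ₊` is invariant under `Ū ⊗ U`. This contradicts
the assumed inequality (`exists_covariant_of_forall_le`). Part (II) is the case of a family with one
member. -/

noncomputable section

/-! ### Invariance of normalized Haar measure on a compact group. -/

section Haar

open MeasureTheory Measure

variable {G : Type*} [Group G] [TopologicalSpace G] [IsTopologicalGroup G] [CompactSpace G]
  [MeasurableSpace G] [BorelSpace G]

local notation "μG" => haarMeasure (⊤ : TopologicalSpace.PositiveCompacts G)

instance isProbabilityMeasure_haarMeasure_top :
    IsProbabilityMeasure (haarMeasure (⊤ : TopologicalSpace.PositiveCompacts G)) :=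
  ⟨by simpa using haarMeasure_self (K₀ := (⊤ : TopologicalSpace.PositiveCompacts G))⟩

instance isMulRightInvariant_haarMeasure_top :
    IsMulRightInvariant (haarMeasure (⊤ : TopologicalSpace.PositiveCompacts G)) where
  map_mul_right_eq_self g := by
    have : IsProbabilityMeasure (map (· * g) μG) :=
      isProbabilityMeasure_map (measurable_mul_const g).aemeasurable
    exact isHaarMeasure_eq_of_isProbabilityMeasure _ _

/-- Right invariance of the measure makes its image under inversion left invariant, so uniqueness of
the Haar probability measure applies. -/
instance isInvInvariant_haarMeasure_top :
    IsInvInvariant (haarMeasure (⊤ : TopologicalSpace.PositiveCompacts G)) where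
  inv_eq_self := by
    have : IsProbabilityMeasure (μG).inv :=
      isProbabilityMeasure_map measurable_inv.aemeasurable
    have : IsHaarMeasure (μG).inv :=
      isHaarMeasure_of_isCompact_nonempty_interior _ Set.univ isCompact_univ
        (by simp) (by simp) (by simp)
    exact isHaarMeasure_eq_of_isProbabilityMeasure _ _

end Haar

/-! ### Two positivity tools. -/

section PosSemidef

variable {m n : Type*}

/-- Summing the entries of a positive semidefinite matrix over blocks preserves positivity. -/
theorem Matrix.PosSemidef.blockSum [Fintype m] [Fintype n] [DecidableEq n]
    {Z : Matrix (n × m) (n × m) ℂ} (hZ : Z.PosSemidef) :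
    (Matrix.of fun p q => ∑ i, ∑ j, Z (p, i) (q, j)).PosSemidef := by
  -- Summation over blocks is compression by the 0/1 matrix that forgets the second index.
  convert hZ.mul_mul_conjTranspose_same
    (Matrix.of fun (p : n) (q : n × m) => if p = q.1 then (1 : ℂ) else 0) using 1
  ext p q
  simp only [Matrix.mul_apply, Matrix.of_apply, Matrix.conjTranspose_apply,
    Fintype.sum_prod_type_right, ite_mul, one_mul, zero_mul, Finset.sum_ite_eq, Finset.mem_univ,
    if_true, apply_ite star, star_one, star_zero, mul_ite, mul_one, mul_zero]
  rw [Finset.sum_comm]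

theorem Matrix.IsHermitian.exists_add_smul_one_posSemidef [Fintype n] [DecidableEq n]
    {A : Matrix n n ℂ} (hA : A.IsHermitian) :
    ∃ r₀ : ℝ, ∀ r : ℝ, r₀ ≤ r → (A + (r : ℂ) • (1 : Matrix n n ℂ)).PosSemidef := by
  open scoped MatrixOrder Matrix.Norms.L2Operator in
  refine ⟨‖A‖, fun r hr => ?_⟩
  have h : -(algebraMap ℝ (Matrix n n ℂ) ‖A‖) ≤ A :=
    IsSelfAdjoint.neg_algebraMap_norm_le_self hA
  rw [Matrix.le_iff] at h
  have h' : ((((r - ‖A‖ : ℝ) : ℂ)) • (1 : Matrix n n ℂ)).PosSemidef :=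
    Matrix.PosSemidef.one.smul (by simpa using hr)
  have e : A + (r : ℂ) • (1 : Matrix n n ℂ) = A - -(algebraMap ℝ (Matrix n n ℂ) ‖A‖) +
      ((r - ‖A‖ : ℝ) : ℂ) • (1 : Matrix n n ℂ) := by
    rw [Algebra.algebraMap_eq_smul_one]
    ext i j
    simp [sub_mul]
  rw [e]
  exact h.add h'

end PosSemidef

/-! ### The twirl as an invariant, positive, self-adjoint projection. -/

section Twirl

open MeasureTheory Measure

variable {G : Type*} [Group G]
variable {s t : Type*} [Fintype s] [DecidableEq s] [Fintype t] [DecidableEq t]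

theorem conjKron_mul (U : G →* Matrix.unitaryGroup t ℂ) (V : G →* Matrix.unitaryGroup s ℂ)
    (g h : G) : conjKron U V (g * h) = conjKron U V g * conjKron U V h := by
  have : ∀ A B : Matrix t t ℂ, (A * B).map star = A.map star * B.map star := fun A B =>
    Matrix.map_mul (f := starRingEnd ℂ)
  simp only [conjKron, map_mul, Matrix.UnitaryGroup.mul_val, this, Matrix.mul_kronecker_mul]

theorem conjKron_one (U : G →* Matrix.unitaryGroup t ℂ) (V : G →* Matrix.unitaryGroup s ℂ) :
    conjKron U V 1 = 1 := by
  simp only [conjKron, map_one, Matrix.UnitaryGroup.one_val]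
  rw [Matrix.map_one _ (star_zero _) (star_one _), Matrix.one_kronecker_one]

theorem conjKron_inv (U : G →* Matrix.unitaryGroup t ℂ) (V : G →* Matrix.unitaryGroup s ℂ)
    (g : G) : conjKron U V g⁻¹ = (conjKron U V g)ᴴ := by
  have : (U g⁻¹ : Matrix t t ℂ) = (U g : Matrix t t ℂ)ᴴ := by
    rw [map_inv, Matrix.UnitaryGroup.inv_val, Matrix.star_eq_conjTranspose]
  have h' : (V g⁻¹ : Matrix s s ℂ) = (V g : Matrix s s ℂ)ᴴ := by
    rw [map_inv, Matrix.UnitaryGroup.inv_val, Matrix.star_eq_conjTranspose]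
  rw [conjKron, conjKron, this, h', Matrix.conjTranspose_kronecker]
  rfl

theorem conjTranspose_conjKron_mul_self (U : G →* Matrix.unitaryGroup t ℂ)
    (V : G →* Matrix.unitaryGroup s ℂ) (g : G) : (conjKron U V g)ᴴ * conjKron U V g = 1 := by
  rw [← conjKron_inv, ← conjKron_mul, inv_mul_cancel, conjKron_one]

theorem trace_conj_conjKron (U : G →* Matrix.unitaryGroup t ℂ)
    (V : G →* Matrix.unitaryGroup s ℂ) (g : G) (X : Matrix (t × s) (t × s) ℂ) :
    (conjKron U V g * X * (conjKron U V g)ᴴ).trace = X.trace := by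
  rw [Matrix.trace_mul_comm, ← mul_assoc, conjTranspose_conjKron_mul_self, one_mul]

variable [TopologicalSpace G]

theorem continuous_conjKron {U : G →* Matrix.unitaryGroup t ℂ} (hU : Continuous U)
    {V : G →* Matrix.unitaryGroup s ℂ} (hV : Continuous V) : Continuous (conjKron U V) := by
  have hU' : Continuous fun g => (U g : Matrix t t ℂ) := continuous_subtype_val.comp hU
  have hV' : Continuous fun g => (V g : Matrix s s ℂ) := continuous_subtype_val.comp hV
  refine continuous_matrix fun p q => ?_
  simp only [conjKron, Matrix.kroneckerMap_apply, Matrix.map_apply]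
  exact (hU'.matrix_elem _ _).star.mul (hV'.matrix_elem _ _)

variable [IsTopologicalGroup G] [CompactSpace G] [MeasurableSpace G] [BorelSpace G]

local notation "μG" => haarMeasure (⊤ : TopologicalSpace.PositiveCompacts G)

theorem integrable_linearMap_conj_conjKron {U : G →* Matrix.unitaryGroup t ℂ} (hU : Continuous U)
    {V : G →* Matrix.unitaryGroup s ℂ} (hV : Continuous V) (X : Matrix (t × s) (t × s) ℂ)
    (f : Matrix (t × s) (t × s) ℂ →ₗ[ℂ] ℂ) :
    Integrable (fun g => f (conjKron U V g * X * (conjKron U V g)ᴴ)) μG := by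
  have hW := continuous_conjKron hU hV
  refine Continuous.integrable_of_hasCompactSupport ?_ (HasCompactSupport.of_compactSpace _)
  exact (LinearMap.continuous_of_finiteDimensional f).comp
    ((hW.matrix_mul continuous_const).matrix_mul hW.matrix_conjTranspose)

theorem linearMap_apply_eq_sum {m n : Type*} [Fintype m] [DecidableEq m] [Fintype n]
    [DecidableEq n] {M : Type*} [AddCommMonoid M] [Module ℂ M]
    (f : Matrix m n ℂ →ₗ[ℂ] M) (X : Matrix m n ℂ) :
    f X = ∑ i, ∑ j, X i j • f (Matrix.single i j 1) := by
  conv_lhs => rw [Matrix.matrix_eq_sum_single X]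
  simp only [_root_.map_sum, ← map_smul, Matrix.smul_single, smul_eq_mul, mul_one]

/-- Linear functionals commute with the twirling integral. -/
theorem linearMap_twirl {U : G →* Matrix.unitaryGroup t ℂ} (hU : Continuous U)
    {V : G →* Matrix.unitaryGroup s ℂ} (hV : Continuous V)
    (f : Matrix (t × s) (t × s) ℂ →ₗ[ℂ] ℂ) (X : Matrix (t × s) (t × s) ℂ) :
    f (twirl U V X) = ∫ g, f (conjKron U V g * X * (conjKron U V g)ᴴ) ∂μG := by
  have hint : ∀ p q, Integrable
      (fun g => (conjKron U V g * X * (conjKron U V g)ᴴ) p q) μG := fun p q =>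
    integrable_linearMap_conj_conjKron hU hV X (Matrix.entryLinearMap ℂ ℂ p q)
  have hf := fun g => linearMap_apply_eq_sum f (conjKron U V g * X * (conjKron U V g)ᴴ)
  rw [linearMap_apply_eq_sum f (twirl U V X), funext hf]
  rw [integral_finsetSum _ fun p _ => integrable_finsetSum _ fun q _ => (hint p q).smul_const _]
  refine Finset.sum_congr rfl fun p _ => ?_
  rw [integral_finsetSum _ fun q _ => (hint p q).smul_const _]
  refine Finset.sum_congr rfl fun q _ => ?_
  rw [integral_smul_const]
  rfl

theorem twirl_add {U : G →* Matrix.unitaryGroup t ℂ} (hU : Continuous U)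
    {V : G →* Matrix.unitaryGroup s ℂ} (hV : Continuous V) (X Y : Matrix (t × s) (t × s) ℂ) :
    twirl U V (X + Y) = twirl U V X + twirl U V Y := by
  have hint : ∀ (X : Matrix (t × s) (t × s) ℂ) p q, Integrable
      (fun g => (conjKron U V g * X * (conjKron U V g)ᴴ) p q) μG := fun X p q =>
    integrable_linearMap_conj_conjKron hU hV X (Matrix.entryLinearMap ℂ ℂ p q)
  ext p q
  simp only [twirl, Matrix.of_apply, Matrix.add_apply, mul_add, add_mul]
  exact integral_add (hint X p q) (hint Y p q)

theorem twirl_smul (U : G →* Matrix.unitaryGroup t ℂ)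
    (V : G →* Matrix.unitaryGroup s ℂ) (z : ℂ) (X : Matrix (t × s) (t × s) ℂ) :
    twirl U V (z • X) = z • twirl U V X := by
  ext p q
  simp only [twirl, Matrix.of_apply, Matrix.smul_apply, Matrix.mul_smul, Matrix.smul_mul]
  exact integral_smul z _

theorem twirl_sub {U : G →* Matrix.unitaryGroup t ℂ} (hU : Continuous U)
    {V : G →* Matrix.unitaryGroup s ℂ} (hV : Continuous V) (X Y : Matrix (t × s) (t × s) ℂ) :
    twirl U V (X - Y) = twirl U V X - twirl U V Y := by
  have h := twirl_smul U V (-1) Y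
  rw [neg_one_smul, neg_one_smul] at h
  rw [sub_eq_add_neg, twirl_add hU hV, h, sub_eq_add_neg]

theorem trace_twirl {U : G →* Matrix.unitaryGroup t ℂ} (hU : Continuous U)
    {V : G →* Matrix.unitaryGroup s ℂ} (hV : Continuous V) (X : Matrix (t × s) (t × s) ℂ) :
    (twirl U V X).trace = X.trace := by
  have h := linearMap_twirl hU hV (Matrix.traceLinearMap (t × s) ℂ ℂ) X
  simpa [trace_conj_conjKron] using h

theorem Matrix.IsHermitian.twirl {X : Matrix (t × s) (t × s) ℂ} (hX : X.IsHermitian)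
    (U : G →* Matrix.unitaryGroup t ℂ) (V : G →* Matrix.unitaryGroup s ℂ) :
    (twirl U V X).IsHermitian := by
  ext p q
  simp only [_root_.twirl, Matrix.conjTranspose_apply, Matrix.of_apply]
  rw [← starRingEnd_apply, ← integral_conj]
  refine integral_congr_ae (Filter.Eventually.of_forall fun g => ?_)
  exact (Matrix.isHermitian_mul_mul_conjTranspose (conjKron U V g) hX).apply p q

theorem Matrix.PosSemidef.twirl {X : Matrix (t × s) (t × s) ℂ} (hX : X.PosSemidef)
    {U : G →* Matrix.unitaryGroup t ℂ} (hU : Continuous U)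
    {V : G →* Matrix.unitaryGroup s ℂ} (hV : Continuous V) : (twirl U V X).PosSemidef := by
  refine .of_dotProduct_mulVec_nonneg (hX.isHermitian.twirl U V) fun x => ?_
  let f : Matrix (t × s) (t × s) ℂ →ₗ[ℂ] ℂ :=
    { toFun := fun Z => star x ⬝ᵥ (Z *ᵥ x)
      map_add' := fun Y Z => by rw [Matrix.add_mulVec, dotProduct_add]
      map_smul' := fun z Z => by
        rw [Matrix.smul_mulVec, dotProduct_smul, RingHom.id_apply] }
  have h := linearMap_twirl hU hV f X
  change star x ⬝ᵥ (_root_.twirl U V X *ᵥ x) = _ at h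
  rw [h]
  exact integral_nonneg fun g => (hX.mul_mul_conjTranspose_same _).dotProduct_mulVec_nonneg x

theorem conj_twirl {U : G →* Matrix.unitaryGroup t ℂ} (hU : Continuous U)
    {V : G →* Matrix.unitaryGroup s ℂ} (hV : Continuous V) (X : Matrix (t × s) (t × s) ℂ)
    (h : G) : conjKron U V h * twirl U V X * (conjKron U V h)ᴴ = twirl U V X := by
  ext p q
  let f : Matrix (t × s) (t × s) ℂ →ₗ[ℂ] ℂ :=
    Matrix.entryLinearMap ℂ ℂ p q ∘ₗ LinearMap.mulRight ℂ (conjKron U V h)ᴴ ∘ₗ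
      LinearMap.mulLeft ℂ (conjKron U V h)
  have hf := linearMap_twirl hU hV f X
  refine hf.trans ?_
  refine Eq.trans ?_ (integral_mul_left_eq_self
    (fun g => (conjKron U V g * X * (conjKron U V g)ᴴ) p q) h)
  refine integral_congr_ae (Filter.Eventually.of_forall fun g => ?_)
  simp only [f, LinearMap.comp_apply, LinearMap.mulLeft_apply, LinearMap.mulRight_apply,
    Matrix.entryLinearMap_apply, conjKron_mul, Matrix.conjTranspose_mul, mul_assoc]

/-- The twirl is self-adjoint for the trace pairing. -/
theorem trace_mul_twirl {U : G →* Matrix.unitaryGroup t ℂ} (hU : Continuous U)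
    {V : G →* Matrix.unitaryGroup s ℂ} (hV : Continuous V) (X Y : Matrix (t × s) (t × s) ℂ) :
    (X * twirl U V Y).trace = (twirl U V X * Y).trace := by
  have h₁ := linearMap_twirl hU hV
    (Matrix.traceLinearMap (t × s) ℂ ℂ ∘ₗ LinearMap.mulLeft ℂ X) Y
  have h₂ := linearMap_twirl hU hV
    (Matrix.traceLinearMap (t × s) ℂ ℂ ∘ₗ LinearMap.mulRight ℂ Y) X
  simp only [LinearMap.comp_apply, LinearMap.mulLeft_apply, LinearMap.mulRight_apply,
    Matrix.traceLinearMap_apply] at h₁ h₂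
  -- Inverting `g` exchanges `conjKron U V g` with its adjoint; cyclicity of the trace then matches
  -- the integrands.
  rw [h₁, h₂, ← integral_inv_eq_self]
  refine integral_congr_ae (Filter.Eventually.of_forall fun g => ?_)
  simp only [conjKron_inv, Matrix.conjTranspose_conjTranspose]
  rw [← mul_assoc, Matrix.trace_mul_comm]
  simp only [mul_assoc]

end Twirl

/-! ### Maps acting on one tensor factor. -/

section TensorMaps

variable {r s t : Type*}

theorem idTensor_apply_eq_sum [Fintype s] [DecidableEq s] (E : Matrix s s ℂ →ₗ[ℂ] Matrix t t ℂ)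
    (X : Matrix (r × s) (r × s) ℂ) (p q : r × t) :
    idTensor E X p q =
      ∑ x, ∑ y, X (p.1, x) (q.1, y) * E (Matrix.single x y 1) p.2 q.2 := by
  simp only [idTensor, Matrix.of_apply]
  rw [linearMap_apply_eq_sum E]
  simp only [Matrix.sum_apply, Matrix.smul_apply, smul_eq_mul, Matrix.of_apply]

theorem tensorId_apply_eq_sum [Fintype r] [DecidableEq r] (Φ : Matrix r r ℂ →ₗ[ℂ] Matrix t t ℂ)
    (X : Matrix (r × s) (r × s) ℂ) (p q : t × s) :
    tensorId Φ X p q =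
      ∑ i, ∑ j, X (i, p.2) (j, q.2) * Φ (Matrix.single i j 1) p.1 q.1 := by
  simp only [tensorId, Matrix.of_apply]
  rw [linearMap_apply_eq_sum Φ]
  simp only [Matrix.sum_apply, Matrix.smul_apply, smul_eq_mul, Matrix.of_apply]

theorem idTensor_eq_submatrix_tensorId (E : Matrix s s ℂ →ₗ[ℂ] Matrix t t ℂ)
    (X : Matrix (r × s) (r × s) ℂ) :
    idTensor E X = (tensorId E (X.submatrix Prod.swap Prod.swap)).submatrix Prod.swap Prod.swap :=
  rfl

theorem idTensor_sub (E : Matrix s s ℂ →ₗ[ℂ] Matrix t t ℂ) (X Y : Matrix (r × s) (r × s) ℂ) :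
    idTensor E (X - Y) = idTensor E X - idTensor E Y := by
  ext p q
  simp only [idTensor, Matrix.of_apply, Matrix.sub_apply]
  rw [← Matrix.sub_apply, ← map_sub]
  rfl

theorem idTensor_kronecker (E : Matrix s s ℂ →ₗ[ℂ] Matrix t t ℂ) (A : Matrix r r ℂ)
    (B : Matrix s s ℂ) : idTensor E (A ⊗ₖ B) = A ⊗ₖ E B := by
  ext p q
  simp only [idTensor, Matrix.of_apply, Matrix.kroneckerMap_apply]
  rw [← smul_eq_mul, ← Matrix.smul_apply, ← map_smul]
  rfl

theorem tensorId_idTensor {r' s' : Type*} [Fintype r] [DecidableEq r] [Fintype s] [DecidableEq s]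
    (Φ : Matrix r r ℂ →ₗ[ℂ] Matrix r' r' ℂ) (E : Matrix s s ℂ →ₗ[ℂ] Matrix s' s' ℂ)
    (X : Matrix (r × s) (r × s) ℂ) :
    tensorId Φ (idTensor E X) = idTensor E (tensorId Φ X) := by
  ext p q
  rw [tensorId_apply_eq_sum, idTensor_apply_eq_sum]
  simp only [tensorId_apply_eq_sum, idTensor_apply_eq_sum, Finset.sum_mul]
  simp_rw [← Fintype.sum_prod_type' (f := fun (x : r) (y : r) => _),
    ← Fintype.sum_prod_type' (f := fun (x : s) (y : s) => _)]
  rw [Finset.sum_comm]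
  simp only [mul_right_comm]

/-- Complete positivity is defined with reference systems `Fin k`; relabelling extends it to any
finite index type. -/
theorem IsCPTP.posSemidef_idTensor [Fintype r] [Fintype s] [Fintype t]
    {E : Matrix s s ℂ →ₗ[ℂ] Matrix t t ℂ} (hE : IsCPTP E) {X : Matrix (r × s) (r × s) ℂ}
    (hX : X.PosSemidef) : (idTensor E X).PosSemidef := by
  let e := Fintype.equivFin r
  have h := hE.completelyPositive _ _ (hX.submatrix (Prod.map e.symm id))
  convert h.submatrix (Prod.map e id) using 1
  ext p q
  simp [idTensor, Matrix.submatrix]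

theorem IsCPTP.posSemidef_tensorId [Fintype r] [Fintype s] [Fintype t]
    {Φ : Matrix r r ℂ →ₗ[ℂ] Matrix t t ℂ} (hΦ : IsCPTP Φ) {X : Matrix (r × s) (r × s) ℂ}
    (hX : X.PosSemidef) : (tensorId Φ X).PosSemidef :=
  (hΦ.posSemidef_idTensor (hX.submatrix Prod.swap)).submatrix Prod.swap

theorem IsCPTP.posSemidef_apply [Fintype s] [Fintype t]
    {E : Matrix s s ℂ →ₗ[ℂ] Matrix t t ℂ} (hE : IsCPTP E) {X : Matrix s s ℂ}
    (hX : X.PosSemidef) : (E X).PosSemidef :=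
  (hE.posSemidef_idTensor (r := Unit) (hX.submatrix Prod.snd)).submatrix fun x => ((), x)

theorem IsCPTP.trace_tensorId [Fintype r] [Fintype s] [Fintype t]
    {Φ : Matrix r r ℂ →ₗ[ℂ] Matrix t t ℂ} (hΦ : IsCPTP Φ) (X : Matrix (r × s) (r × s) ℂ) :
    (tensorId Φ X).trace = X.trace := by
  have h := fun x : s => hΦ.tracePreserving (Matrix.of fun i j => X (i, x) (j, x))
  simp only [Matrix.trace, Matrix.diag_apply, Matrix.of_apply] at h
  simp only [Matrix.trace, Matrix.diag_apply, Fintype.sum_prod_type_right, tensorId,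
    Matrix.of_apply, h]

theorem IsCPTP.isState_tensorId [Fintype r] [Fintype s] [Fintype t]
    {Φ : Matrix r r ℂ →ₗ[ℂ] Matrix t t ℂ} (hΦ : IsCPTP Φ) {X : Matrix (r × s) (r × s) ℂ}
    (hX : IsState X) : IsState (tensorId Φ X) :=
  ⟨hΦ.posSemidef_tensorId hX.1, (hΦ.trace_tensorId X).trans hX.2⟩

end TensorMaps

/-! ### Conditioning on effects and measure-and-prepare channels. -/

section Measurement

variable {ι r s t : Type*} [Fintype r]

/-- The unnormalized state `Tr₁[(N ⊗ 1) X]` conditioned on the effect `N` on the first factor. -/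
def conditioned (N : Matrix r r ℂ) (X : Matrix (r × s) (r × s) ℂ) : Matrix s s ℂ :=
  Matrix.of fun x y => (N * Matrix.of fun i j => X (i, x) (j, y)).trace

theorem conditioned_apply (N : Matrix r r ℂ) (X : Matrix (r × s) (r × s) ℂ) (x y : s) :
    conditioned N X x y = ∑ i, ∑ k, N i k * X (k, x) (i, y) := by
  simp [conditioned, Matrix.trace, Matrix.mul_apply]

theorem posSemidef_conditioned [Fintype s] [DecidableEq s] [DecidableEq r] {N : Matrix r r ℂ}
    (hN : N.PosSemidef) {X : Matrix (r × s) (r × s) ℂ} (hX : X.PosSemidef) :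
    (conditioned N X).PosSemidef := by
  -- The conditioned operator is the block sum of the principal submatrix of `Nᵀ ⊗ X` in which the
  -- two `r` indices agree.
  have h := ((hN.transpose.kronecker hX).submatrix
    fun p : s × r => (p.2, (p.2, p.1))).blockSum
  convert h using 1
  ext x y
  simp only [conditioned_apply, Matrix.of_apply, Matrix.submatrix_apply,
    Matrix.kroneckerMap_apply, Matrix.transpose_apply]
  rw [Finset.sum_comm]

theorem trace_conditioned [Fintype s] (N : Matrix r r ℂ) (X : Matrix (r × s) (r × s) ℂ) :
    (conditioned N X).trace = (N * marginalFst X).trace := by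
  simp only [Matrix.trace, Matrix.diag_apply, conditioned_apply, Matrix.mul_apply, marginalFst,
    Matrix.of_apply, Finset.mul_sum]
  rw [Finset.sum_comm]
  refine Finset.sum_congr rfl fun i _ => ?_
  rw [Finset.sum_comm]

theorem conditioned_idTensor [Fintype s] [DecidableEq s] (E : Matrix s s ℂ →ₗ[ℂ] Matrix t t ℂ)
    (N : Matrix r r ℂ) (X : Matrix (r × s) (r × s) ℂ) :
    conditioned N (idTensor E X) = E (conditioned N X) := by
  have h : conditioned N X =
      ∑ i, ∑ k, N i k • (Matrix.of fun x y => X (k, x) (i, y)) := by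
    ext x y
    simp [conditioned_apply, Matrix.sum_apply]
  ext x y
  rw [h, conditioned_apply]
  simp only [map_sum, map_smul, Matrix.sum_apply, Matrix.smul_apply, smul_eq_mul]
  rfl

/-- An informationally complete family of effects separates bipartite operators. -/
theorem eq_of_conditioned_eq [DecidableEq r] {M : ι → Matrix r r ℂ}
    (hM : Submodule.span ℂ (Set.range M) = ⊤) {X Y : Matrix (r × s) (r × s) ℂ}
    (h : ∀ j, conditioned (M j) X = conditioned (M j) Y) : X = Y := by
  have key : ∀ N : Matrix r r ℂ, conditioned N X = conditioned N Y := by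
    intro N
    have hN : N ∈ Submodule.span ℂ (Set.range M) := hM ▸ Submodule.mem_top
    induction hN using Submodule.span_induction with
    | mem x hx => obtain ⟨j, rfl⟩ := hx; exact h j
    | zero => ext; simp [conditioned_apply]
    | add A B _ _ hA hB =>
      have e : ∀ Z : Matrix (r × s) (r × s) ℂ,
          conditioned (A + B) Z = conditioned A Z + conditioned B Z := fun Z => by
        ext; simp [conditioned_apply, add_mul, Finset.sum_add_distrib]
      rw [e, e, hA, hB]
    | smul z A _ hA =>
      have e : ∀ Z : Matrix (r × s) (r × s) ℂ,
          conditioned (z • A) Z = z • conditioned A Z := fun Z => by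
        ext; simp [conditioned_apply, mul_assoc, Finset.mul_sum]
      rw [e, e, hA]
  -- Conditioning on matrix units reads off the individual entries.
  have e : ∀ (Z : Matrix (r × s) (r × s) ℂ) (p q : r × s),
      conditioned (Matrix.single q.1 p.1 1) Z p.2 q.2 = Z p q := fun Z p q => by
    rw [conditioned, Matrix.of_apply, Matrix.trace_single_mul, one_smul]
    rfl
  ext p q
  rw [← e X, ← e Y, key]

/-- This is the form `∑ ω_k ⊗ ρ_k` in which the dual certificate of the separation argument appears.
-/
theorem tensorId_measurePrepare [Fintype ι] (M : ι → Matrix r r ℂ) (ω : ι → Matrix t t ℂ)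
    (X : Matrix (r × s) (r × s) ℂ) :
    tensorId (measurePrepare M ω) X = ∑ j, ω j ⊗ₖ conditioned (M j) X := by
  ext p q
  simp only [tensorId, measurePrepare, conditioned, LinearMap.coe_mk, AddHom.coe_mk,
    Matrix.of_apply, Matrix.sum_apply, Matrix.smul_apply, Matrix.kroneckerMap_apply, smul_eq_mul,
    mul_comm]

theorem isCPTP_measurePrepare [Fintype ι] [DecidableEq r] [Fintype t] [DecidableEq t]
    {M : ι → Matrix r r ℂ} (hM : ∀ j, (M j).PosSemidef) (hM₁ : ∑ j, M j = 1)
    {ω : ι → Matrix t t ℂ} (hω : ∀ j, IsState (ω j)) : IsCPTP (measurePrepare M ω) where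
  completelyPositive k X hX := by
    rw [idTensor_eq_submatrix_tensorId, tensorId_measurePrepare]
    exact (Matrix.posSemidef_sum _ fun j _ => (hω j).1.kronecker
      (posSemidef_conditioned (hM j) (hX.submatrix Prod.swap))).submatrix Prod.swap
  tracePreserving X := by
    have h : ∀ j, (ω j).trace = 1 := fun j => (hω j).2
    simp only [measurePrepare, LinearMap.coe_mk, AddHom.coe_mk, Matrix.trace_sum,
      Matrix.trace_smul, h, smul_eq_mul, mul_one]
    rw [← Matrix.trace_sum, ← Finset.sum_mul, hM₁, one_mul]

end Measurement

/-! ### Channels from Choi operators. -/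

section Choi

variable {r s t : Type*} [Fintype s]

/-- The linear map with (transposed) Choi operator `L`. -/
def choiMap (L : Matrix (t × s) (t × s) ℂ) : Matrix s s ℂ →ₗ[ℂ] Matrix t t ℂ where
  toFun X := Matrix.of fun x y => ∑ i, ∑ j, L (y, j) (x, i) * X i j
  map_add' X Y := by ext; simp [mul_add, Finset.sum_add_distrib]
  map_smul' z X := by ext; simp [Finset.mul_sum, mul_left_comm]

theorem choiMap_apply (L : Matrix (t × s) (t × s) ℂ) (X : Matrix s s ℂ) (x y : t) :
    choiMap L X x y = ∑ i, ∑ j, L (y, j) (x, i) * X i j := rfl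

theorem isHermitian_choiMap {L : Matrix (t × s) (t × s) ℂ} (hL : L.IsHermitian)
    {X : Matrix s s ℂ} (hX : X.IsHermitian) : (choiMap L X).IsHermitian := by
  ext x y
  simp only [choiMap_apply, Matrix.conjTranspose_apply, star_sum, star_mul', hL.apply, hX.apply]
  rw [Finset.sum_comm]

variable [Fintype t]

/-- The transpose of the partial trace over the first factor; `choiMap L` preserves traces when
this is the identity. -/
def choiMarginal (L : Matrix (t × s) (t × s) ℂ) : Matrix s s ℂ :=
  Matrix.of fun i j => ∑ x, L (x, j) (x, i)

/-- Here and in `sum_mul_choiMap_apply`, a functional of the channel constraints becomes a trace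
against `L`. The index convention of `choiMap` is what keeps transposes out of these formulas. -/
theorem sum_mul_choiMarginal_apply [DecidableEq t] (L : Matrix (t × s) (t × s) ℂ)
    (A : Matrix s s ℂ) :
    ∑ i, ∑ j, A i j * choiMarginal L i j = (L * ((1 : Matrix t t ℂ) ⊗ₖ A)).trace := by
  simp only [choiMarginal, Matrix.of_apply, Matrix.trace, Matrix.diag_apply, Matrix.mul_apply,
    Fintype.sum_prod_type, Matrix.kroneckerMap_apply, Matrix.one_apply, ite_mul, one_mul, zero_mul,
    mul_ite, mul_zero, Finset.mul_sum]
  simp_rw [Finset.sum_comm (s := (Finset.univ : Finset t)) (t := (Finset.univ : Finset s))]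
  simp only [Finset.sum_ite_eq', Finset.mem_univ, if_true]
  rw [Finset.sum_comm]
  simp only [mul_comm]

theorem sum_mul_choiMap_apply (L : Matrix (t × s) (t × s) ℂ) (Y : Matrix t t ℂ)
    (X : Matrix s s ℂ) :
    ∑ x, ∑ y, Y x y * choiMap L X x y = (L * (Y ⊗ₖ X)).trace := by
  simp only [choiMap_apply, Matrix.trace, Matrix.diag_apply, Matrix.mul_apply,
    Fintype.sum_prod_type, Matrix.kroneckerMap_apply, Finset.mul_sum]
  rw [Finset.sum_comm]
  refine Finset.sum_congr rfl fun y _ => ?_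
  conv_rhs => rw [Finset.sum_comm]
  refine Finset.sum_congr rfl fun x _ => ?_
  rw [Finset.sum_comm]
  simp only [mul_left_comm]

theorem trace_choiMarginal (L : Matrix (t × s) (t × s) ℂ) :
    (choiMarginal L).trace = L.trace := by
  simp only [choiMarginal, Matrix.trace, Matrix.diag_apply, Matrix.of_apply,
    Fintype.sum_prod_type_right]

omit [Fintype s] in
theorem isHermitian_choiMarginal {L : Matrix (t × s) (t × s) ℂ} (hL : L.IsHermitian) :
    (choiMarginal L).IsHermitian := by
  ext i j
  simp only [choiMarginal, Matrix.conjTranspose_apply, Matrix.of_apply, star_sum, hL.apply]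

theorem isCPTP_choiMap [DecidableEq s] [DecidableEq t] {L : Matrix (t × s) (t × s) ℂ}
    (hL : L.PosSemidef) (hL₁ : choiMarginal L = 1) : IsCPTP (choiMap L) where
  completelyPositive k X hX := by
    -- The output is a block sum of a principal submatrix of `Lᵀ ⊗ X`, which is the easy direction
    -- of Choi's theorem.
    have h := ((hL.transpose.kronecker hX).submatrix
      fun p : (Fin k × t) × s => ((p.1.2, p.2), (p.1.1, p.2))).blockSum
    exact h
  tracePreserving X := by
    have h : ∀ i j, ∑ x, L (x, j) (x, i) = if i = j then 1 else 0 := fun i j => by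
      rw [← Matrix.one_apply, ← hL₁]; rfl
    simp only [Matrix.trace, Matrix.diag_apply, choiMap_apply]
    rw [Finset.sum_comm]
    refine Finset.sum_congr rfl fun i _ => ?_
    rw [Finset.sum_comm]
    simp only [← Finset.sum_mul, h]
    simp

theorem isCovariant_choiMap [DecidableEq s] [DecidableEq t] {G : Type*} [Group G]
    {V : G →* Matrix.unitaryGroup s ℂ} {U : G →* Matrix.unitaryGroup t ℂ}
    {L : Matrix (t × s) (t × s) ℂ}
    (hL : ∀ g, conjKron U V g * L * (conjKron U V g)ᴴ = L) : IsCovariant V U (choiMap L) := by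
  have hsum : ∀ Y Z : Matrix t t ℂ, ∑ x, ∑ y, Y x y * Z x y = (Yᵀ * Z).trace := fun Y Z => by
    simp only [Matrix.trace, Matrix.diag_apply, Matrix.mul_apply, Matrix.transpose_apply]
    rw [Finset.sum_comm]
  intro g X
  refine Matrix.ext_iff_trace_mul_left.mpr fun Y => ?_
  obtain ⟨Y, rfl⟩ : ∃ Z, Zᵀ = Y := ⟨Yᵀ, Matrix.transpose_transpose _⟩
  set A := (U g : Matrix t t ℂ)
  set B := (V g : Matrix s s ℂ)
  have hB : Bᴴ * B = 1 := Matrix.UnitaryGroup.star_mul_self (V g)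
  have hW : conjKron U V g = A.map star ⊗ₖ B := rfl
  have e₁ : (Yᵀ * (A * choiMap L X * Aᴴ)).trace
      = ((Aᵀ * Y * (A.map star))ᵀ * choiMap L X).trace := by
    rw [← mul_assoc, Matrix.trace_mul_comm]
    simp only [Matrix.transpose_mul, Matrix.transpose_transpose, mul_assoc]
    rfl
  rw [e₁, ← hsum, ← hsum, sum_mul_choiMap_apply, sum_mul_choiMap_apply]
  conv_rhs => rw [← hL g]
  -- Covariance is tested against an arbitrary `Y`: the group action moves from `Y ⊗ X` to `L`,
  -- where invariance absorbs it.
  have e₂ : (Aᵀ * Y * A.map star) ⊗ₖ X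
      = (conjKron U V g)ᴴ * (Y ⊗ₖ (B * X * Bᴴ)) * conjKron U V g := by
    rw [hW, Matrix.conjTranspose_kronecker, ← Matrix.mul_kronecker_mul,
      ← Matrix.mul_kronecker_mul]
    congr 1
    · congr 2
      ext; simp
    · simp only [mul_assoc, hB, mul_one]
      rw [← mul_assoc, hB, one_mul]
  rw [e₂, ← mul_assoc, Matrix.trace_mul_comm]
  simp only [mul_assoc]

end Choi

/-! ### The semidefinite program behind the min-entropy. -/

section MinEntropy

variable {r s t : Type*} [Fintype r] [DecidableEq r] [Fintype s] [Fintype t]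

/-- The values of the semidefinite program defining the conditional min-entropy. -/
def minEntropyValues (Ω : Matrix (r × s) (r × s) ℂ) : Set ℝ :=
  {x : ℝ | ∃ τ : Matrix s s ℂ, τ.PosSemidef ∧
    ((1 : Matrix r r ℂ) ⊗ₖ τ - Ω).PosSemidef ∧ x = τ.trace.re}

theorem condMinEntropy_eq (Ω : Matrix (r × s) (r × s) ℂ) :
    condMinEntropy Ω = -Real.logb 2 (sInf (minEntropyValues Ω)) := rfl

omit [Fintype r] in
theorem bddBelow_minEntropyValues (Ω : Matrix (r × s) (r × s) ℂ) :
    BddBelow (minEntropyValues Ω) :=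
  ⟨0, by rintro x ⟨τ, hτ, -, rfl⟩; exact (Complex.nonneg_iff.mp hτ.trace_nonneg).1⟩

theorem minEntropyValues_nonempty {Ω : Matrix (r × s) (r × s) ℂ}
    (hΩ : Ω.IsHermitian) : (minEntropyValues Ω).Nonempty := by
  classical
  obtain ⟨r₀, h⟩ := hΩ.neg.exists_add_smul_one_posSemidef
  -- A large multiple of the identity is feasible; the maximum with `0` keeps it positive.
  refine ⟨_, ((max r₀ 0 : ℝ) : ℂ) • 1, Matrix.PosSemidef.one.smul (by simp), ?_, rfl⟩
  rw [Matrix.kronecker_smul, Matrix.one_kronecker_one, sub_eq_add_neg, add_comm]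
  exact h _ (le_max_left _ _)

/-- Taking traces in `1 ⊗ τ ≥ Ω` keeps the infimum away from `0`, so that the logarithm can be
removed from entropy inequalities. -/
theorem one_le_card_mul_of_mem_minEntropyValues {Ω : Matrix (r × s) (r × s) ℂ}
    (hΩ : Ω.trace = 1) {x : ℝ} (hx : x ∈ minEntropyValues Ω) : 1 ≤ Fintype.card r * x := by
  obtain ⟨τ, -, h, rfl⟩ := hx
  have := (Complex.nonneg_iff.mp h.trace_nonneg).1
  rw [Matrix.trace_sub, Matrix.trace_kronecker, Matrix.trace_one, hΩ] at this
  simpa using this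

theorem sInf_minEntropyValues_pos {Ω : Matrix (r × s) (r × s) ℂ} (hΩ : IsState Ω) :
    0 < sInf (minEntropyValues Ω) := by
  have hne := minEntropyValues_nonempty hΩ.1.isHermitian
  have hr : (0 : ℝ) < Fintype.card r := by
    obtain ⟨x, hx⟩ := hne
    have := one_le_card_mul_of_mem_minEntropyValues hΩ.2 hx
    rcases (Nat.cast_nonneg (α := ℝ) (Fintype.card r)).eq_or_lt with h | h
    · rw [← h, zero_mul] at this; linarith
    · exact h
  refine (inv_pos.mpr hr).trans_le (le_csInf hne fun x hx => ?_)
  rw [inv_le_iff_one_le_mul₀' hr]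
  exact one_le_card_mul_of_mem_minEntropyValues hΩ.2 hx

theorem two_rpow_neg_condMinEntropy {Ω : Matrix (r × s) (r × s) ℂ} (hΩ : IsState Ω) :
    (2 : ℝ) ^ (-condMinEntropy Ω) = sInf (minEntropyValues Ω) := by
  rw [condMinEntropy_eq, neg_neg,
    Real.rpow_logb two_pos (by norm_num) (sInf_minEntropyValues_pos hΩ)]

theorem condMinEntropy_le_iff {Ω : Matrix (r × s) (r × s) ℂ} (hΩ : IsState Ω)
    {Ω' : Matrix (r × t) (r × t) ℂ} (hΩ' : IsState Ω') :
    condMinEntropy Ω ≤ condMinEntropy Ω' ↔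
      sInf (minEntropyValues Ω') ≤ sInf (minEntropyValues Ω) := by
  rw [condMinEntropy_eq, condMinEntropy_eq, neg_le_neg_iff,
    Real.logb_le_logb (by norm_num) (sInf_minEntropyValues_pos hΩ')
      (sInf_minEntropyValues_pos hΩ)]

/-- Data processing for the conditional min-entropy. -/
theorem sInf_minEntropyValues_idTensor_le {E : Matrix s s ℂ →ₗ[ℂ] Matrix t t ℂ} (hE : IsCPTP E)
    {Ω : Matrix (r × s) (r × s) ℂ} (hΩ : Ω.IsHermitian) :
    sInf (minEntropyValues (idTensor E Ω)) ≤ sInf (minEntropyValues Ω) := by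
  refine csInf_le_csInf (bddBelow_minEntropyValues _) (minEntropyValues_nonempty hΩ) ?_
  rintro x ⟨τ, hτ, h, rfl⟩
  refine ⟨E τ, hE.posSemidef_apply hτ, ?_, by rw [hE.tracePreserving]⟩
  rw [← idTensor_kronecker, ← idTensor_sub]
  exact hE.posSemidef_idTensor h

end MinEntropy

/-! ### Covariant maps commute with the twirl. -/

section Covariance

variable {r s t : Type*} [Fintype r] [Fintype s]

/-- The first factor only mixes blocks linearly, so a linear map applied blockwise sees nothing but
conjugation by `B`. -/
theorem kronecker_conj_block (A : Matrix r r ℂ) (B : Matrix s s ℂ)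
    (X : Matrix (r × s) (r × s) ℂ) (i j : r) :
    (Matrix.of fun x y => ((A ⊗ₖ B) * X * (A ⊗ₖ B)ᴴ) (i, x) (j, y))
      = ∑ k, ∑ l, (A i k * star (A j l)) • (B * (Matrix.of fun x y => X (k, x) (l, y)) * Bᴴ) := by
  ext x y
  simp only [Matrix.of_apply, Matrix.mul_apply, Matrix.sum_apply, Matrix.smul_apply,
    Fintype.sum_prod_type, Matrix.kroneckerMap_apply, Matrix.conjTranspose_apply, smul_eq_mul,
    Finset.sum_mul, Finset.mul_sum, star_mul']
  conv_rhs => rw [Finset.sum_comm]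
  refine Finset.sum_congr rfl fun l _ => ?_
  rw [Finset.sum_comm]
  refine Finset.sum_congr rfl fun k _ => ?_
  refine Finset.sum_congr rfl fun y' _ => Finset.sum_congr rfl fun x' _ => ?_
  ring

theorem IsCovariant.conj_idTensor [DecidableEq r] [DecidableEq s] [Fintype t] [DecidableEq t]
    {G : Type*} [Group G] {V : G →* Matrix.unitaryGroup s ℂ} {U : G →* Matrix.unitaryGroup t ℂ}
    {E : Matrix s s ℂ →ₗ[ℂ] Matrix t t ℂ} (hE : IsCovariant V U E)
    (T : G →* Matrix.unitaryGroup r ℂ) (X : Matrix (r × s) (r × s) ℂ) (g : G) :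
    conjKron T U g * idTensor E X * (conjKron T U g)ᴴ
      = idTensor E (conjKron T V g * X * (conjKron T V g)ᴴ) := by
  ext p q
  have h := congr_fun₂ (kronecker_conj_block ((T g : Matrix r r ℂ).map star)
    (U g : Matrix t t ℂ) (idTensor E X) p.1 q.1) p.2 q.2
  refine h.trans ?_
  simp only [idTensor, Matrix.of_apply]
  rw [conjKron, kronecker_conj_block]
  simp only [map_sum, map_smul, ← hE g, Matrix.sum_apply]
  rfl

theorem IsCovariant.twirl_idTensor [DecidableEq r] [DecidableEq s] [Fintype t] [DecidableEq t]
    {G : Type*} [Group G] [TopologicalSpace G] [IsTopologicalGroup G] [CompactSpace G]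
    [MeasurableSpace G] [BorelSpace G]
    {V : G →* Matrix.unitaryGroup s ℂ} (hV : Continuous V) {U : G →* Matrix.unitaryGroup t ℂ}
    {T : G →* Matrix.unitaryGroup r ℂ} (hT : Continuous T)
    {E : Matrix s s ℂ →ₗ[ℂ] Matrix t t ℂ} (hE : IsCovariant V U E)
    (X : Matrix (r × s) (r × s) ℂ) :
    twirl T U (idTensor E X) = idTensor E (twirl T V X) := by
  ext p q
  let f : Matrix (r × s) (r × s) ℂ →ₗ[ℂ] ℂ :=
    { toFun := fun Z => idTensor E Z p q
      map_add' := fun Y Z => by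
        simp only [idTensor_apply_eq_sum, Matrix.add_apply, add_mul, Finset.sum_add_distrib]
      map_smul' := fun z Z => by
        simp only [idTensor_apply_eq_sum, Matrix.smul_apply, smul_eq_mul, mul_assoc,
          Finset.mul_sum, RingHom.id_apply] }
  have h := linearMap_twirl hT hV f X
  refine Eq.trans ?_ h.symm
  simp only [f, LinearMap.coe_mk, AddHom.coe_mk, ← hE.conj_idTensor]
  rfl

end Covariance

/-! ### Singlet fraction and invariance of the maximally entangled vector. -/

section MaxEntangled

variable {c : Type*} [Fintype c] [DecidableEq c]

theorem card_mul_star_maxEntangled_dotProduct [Nonempty c] (X : Matrix (c × c) (c × c) ℂ) :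
    (Fintype.card c : ℂ) * (star (maxEntangled c) ⬝ᵥ (X *ᵥ maxEntangled c))
      = ∑ x, ∑ y, X (x, x) (y, y) := by
  have hd : (Fintype.card c : ℂ) * (((1 / Real.sqrt (Fintype.card c) : ℝ) : ℂ) *
      ((1 / Real.sqrt (Fintype.card c) : ℝ) : ℂ)) = 1 := by
    have h : (Fintype.card c : ℝ) ≠ 0 := by simp
    rw [← Complex.ofReal_mul, ← pow_two, div_pow, Real.sq_sqrt (Nat.cast_nonneg _), one_pow,
      ← Complex.ofReal_natCast, ← Complex.ofReal_mul, mul_one_div_cancel h, Complex.ofReal_one]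
  simp only [dotProduct, Matrix.mulVec, Fintype.sum_prod_type, Pi.star_apply, maxEntangled,
    apply_ite star, star_zero, ite_mul, zero_mul, Finset.sum_ite_eq, Finset.mem_univ, if_true,
    mul_ite, mul_zero]
  simp only [Finset.mul_sum]
  refine Finset.sum_congr rfl fun x _ => Finset.sum_congr rfl fun y _ => ?_
  rw [Complex.star_def, Complex.conj_ofReal]
  linear_combination X (x, x) (y, y) * hd

theorem card_mul_expectation_maxEntangled [Nonempty c] (X : Matrix (c × c) (c × c) ℂ) :
    (Fintype.card c : ℝ) * expectation (maxEntangled c) X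
      = (∑ x, ∑ y, X (x, x) (y, y)).re := by
  rw [← card_mul_star_maxEntangled_dotProduct, expectation, ← Complex.ofReal_natCast,
    Complex.re_ofReal_mul]

/-- The singlet fraction bounds the guessing probability from below. -/
theorem card_mul_expectation_maxEntangled_le [Nonempty c] {Ω : Matrix (c × c) (c × c) ℂ} {x : ℝ}
    (hx : x ∈ minEntropyValues Ω) :
    (Fintype.card c : ℝ) * expectation (maxEntangled c) Ω ≤ x := by
  obtain ⟨τ, -, h, rfl⟩ := hx
  have h₀ : 0 ≤ expectation (maxEntangled c) ((1 : Matrix c c ℂ) ⊗ₖ τ - Ω) :=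
    (Complex.nonneg_iff.mp (h.dotProduct_mulVec_nonneg (maxEntangled c))).1
  have h₁ := mul_nonneg (Nat.cast_nonneg (α := ℝ) (Fintype.card c)) h₀
  have h₂ : ∑ x, ∑ y, ((1 : Matrix c c ℂ) ⊗ₖ τ) (x, x) (y, y) = τ.trace := by
    simp [Matrix.one_apply, Matrix.trace]
  rw [card_mul_expectation_maxEntangled] at h₁ ⊢
  simp only [Matrix.sub_apply, Finset.sum_sub_distrib, h₂, Complex.sub_re] at h₁
  linarith

variable {G : Type*} [Group G] [TopologicalSpace G] [IsTopologicalGroup G] [CompactSpace G]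
  [MeasurableSpace G] [BorelSpace G]

omit [TopologicalSpace G] [IsTopologicalGroup G] [CompactSpace G] [MeasurableSpace G]
  [BorelSpace G] in
-- Read as a matrix, the image of `∑ |i⟩|i⟩` is the transpose of `U Uᴴ = 1`.
theorem conjKron_mulVec_diag (U : G →* Matrix.unitaryGroup c ℂ) (g : G) :
    conjKron U U g *ᵥ (fun p => if p.1 = p.2 then 1 else 0)
      = fun p => if p.1 = p.2 then 1 else 0 := by
  have hU : (U g : Matrix c c ℂ) * (U g : Matrix c c ℂ)ᴴ = 1 :=
    Matrix.mem_unitaryGroup_iff.mp (U g).2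
  ext p
  have h := congr_fun₂ hU p.2 p.1
  rw [Matrix.mul_apply, Matrix.one_apply] at h
  simp only [Matrix.conjTranspose_apply] at h
  simp only [Matrix.mulVec, dotProduct, Fintype.sum_prod_type, conjKron,
    Matrix.kroneckerMap_apply, Matrix.map_apply, mul_ite, mul_one, mul_zero, Finset.sum_ite_eq,
    Finset.mem_univ, if_true, eq_comm (a := p.1)]
  rw [← h]
  exact Finset.sum_congr rfl fun x _ => mul_comm _ _

/-- Invariance of the maximally entangled vector makes the integrand constant, so the twirl can be
dropped from singlet fractions. -/
theorem sum_diag_twirl {U : G →* Matrix.unitaryGroup c ℂ} (hU : Continuous U)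
    (X : Matrix (c × c) (c × c) ℂ) :
    ∑ x, ∑ y, twirl U U X (x, x) (y, y) = ∑ x, ∑ y, X (x, x) (y, y) := by
  let e : c × c → ℂ := fun p => if p.1 = p.2 then 1 else 0
  have he : ∀ Z : Matrix (c × c) (c × c) ℂ,
      star e ⬝ᵥ (Z *ᵥ e) = ∑ x, ∑ y, Z (x, x) (y, y) := fun Z => by
    simp only [e, dotProduct, Matrix.mulVec, Fintype.sum_prod_type, Pi.star_apply,
      apply_ite star, star_zero, star_one, ite_mul, one_mul, zero_mul, Finset.sum_ite_eq,
      Finset.mem_univ, if_true, mul_ite, mul_one, mul_zero]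
  let f : Matrix (c × c) (c × c) ℂ →ₗ[ℂ] ℂ :=
    { toFun := fun Z => star e ⬝ᵥ (Z *ᵥ e)
      map_add' := fun Y Z => by rw [Matrix.add_mulVec, dotProduct_add]
      map_smul' := fun z Z => by
        rw [Matrix.smul_mulVec, dotProduct_smul, RingHom.id_apply] }
  have hf : ∀ g, f (conjKron U U g * X * (conjKron U U g)ᴴ) = f X := fun g => by
    have h : (conjKron U U g)ᴴ *ᵥ e = e := by
      rw [← conjKron_inv]
      exact conjKron_mulVec_diag U g⁻¹
    change star e ⬝ᵥ (_ *ᵥ e) = star e ⬝ᵥ (X *ᵥ e)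
    rw [mul_assoc, ← Matrix.mulVec_mulVec, ← Matrix.mulVec_mulVec, h, Matrix.dotProduct_mulVec,
      ← Matrix.conjTranspose_conjTranspose (conjKron U U g), ← Matrix.star_mulVec, h]
  have h := linearMap_twirl hU hU f X
  simp only [hf, MeasureTheory.integral_const, MeasureTheory.probReal_univ, one_smul] at h
  rw [← he, ← he]
  exact h

end MaxEntangled

/-! ### Hermitian functionals and compactness of positive operators of fixed trace. -/

section Duality

variable {n : Type*} [Fintype n] [DecidableEq n]

/-- On Hermitian matrices, every real functional is the entrywise pairing with a Hermitian
matrix. -/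
theorem exists_isHermitian_forall_eq_re_sum (f : Matrix n n ℂ →ₗ[ℝ] ℝ) :
    ∃ A : Matrix n n ℂ, A.IsHermitian ∧
      ∀ X : Matrix n n ℂ, X.IsHermitian → f X = (∑ x, ∑ y, A x y * X x y).re := by
  let F : Matrix n n ℂ →ₗ[ℂ] ℂ := Module.Dual.extendRCLike (𝕜 := ℂ) f
  let B : Matrix n n ℂ := Matrix.of fun x y => F (Matrix.single x y 1)
  -- Against Hermitian `X`, `B` and `Bᴴ` give conjugate pairings, so averaging them leaves the real
  -- part unchanged.
  refine ⟨(1 / 2 : ℂ) • (B + Bᴴ), ?_, fun X hX => ?_⟩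
  · ext x y
    simp [add_comm, mul_add]
  have hF : f X = (∑ x, ∑ y, B x y * X x y).re := by
    have h₁ : (F X).re = f X := Module.Dual.re_extendRCLike_apply (𝕜 := ℂ) f X
    rw [← h₁, linearMap_apply_eq_sum F X]
    simp only [B, Matrix.of_apply, smul_eq_mul, mul_comm]
  have hc : ∑ x, ∑ y, Bᴴ x y * X x y = star (∑ x, ∑ y, B x y * X x y) := by
    simp only [star_sum, star_mul']
    rw [Finset.sum_comm]
    refine Finset.sum_congr rfl fun x _ => Finset.sum_congr rfl fun y _ => ?_
    rw [Matrix.conjTranspose_apply, hX.apply]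
  have hs : ∑ x, ∑ y, ((1 / 2 : ℂ) • (B + Bᴴ)) x y * X x y
      = (1 / 2 : ℂ) * (∑ x, ∑ y, B x y * X x y + ∑ x, ∑ y, Bᴴ x y * X x y) := by
    simp only [← Finset.sum_add_distrib, Finset.mul_sum, Matrix.smul_apply, Matrix.add_apply,
      smul_eq_mul]
    refine Finset.sum_congr rfl fun x _ => Finset.sum_congr rfl fun y _ => ?_
    ring
  rw [hs, hc, hF, Complex.star_def, Complex.add_conj]
  simp

/-- The set is the image under `N ↦ Nᴴ N` of the matrices with squared Frobenius norm `d`, which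
form a closed bounded set. -/
theorem isCompact_setOf_posSemidef_trace_eq (d : ℝ) :
    IsCompact {L : Matrix n n ℂ | L.PosSemidef ∧ L.trace = d} := by
  have htr : ∀ N : Matrix n n ℂ, (Nᴴ * N).trace = ((∑ i, ∑ j, ‖N j i‖ ^ 2 : ℝ) : ℂ) := fun N => by
    simp only [Matrix.trace, Matrix.diag_apply, Matrix.mul_apply, Matrix.conjTranspose_apply,
      Complex.star_def, Complex.conj_mul', Complex.ofReal_sum, Complex.ofReal_pow]
  have hK : IsCompact {N : Matrix n n ℂ | ∑ i, ∑ j, ‖N j i‖ ^ 2 = d} := by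
    have hball : IsCompact (Set.univ.pi fun _ : n => Set.univ.pi fun _ : n =>
        Metric.closedBall (0 : ℂ) (Real.sqrt d)) :=
      isCompact_univ_pi fun _ => isCompact_univ_pi fun _ => isCompact_closedBall _ _
    refine IsCompact.of_isClosed_subset (X := Matrix n n ℂ) hball
      (isClosed_eq ?_ continuous_const) ?_
    · exact continuous_finsetSum _ fun i _ => continuous_finsetSum _ fun j _ =>
        (continuous_id.matrix_elem j i).norm.pow 2
    · intro N hN j _ i _
      rw [mem_closedBall_zero_iff]
      refine Real.le_sqrt_of_sq_le ?_
      rw [← (show _ = d from hN)]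
      calc ‖N j i‖ ^ 2 ≤ ∑ j, ‖N j i‖ ^ 2 :=
            Finset.single_le_sum (f := fun j => ‖N j i‖ ^ 2) (fun _ _ => by positivity)
              (Finset.mem_univ j)
        _ ≤ ∑ i, ∑ j, ‖N j i‖ ^ 2 :=
            Finset.single_le_sum (f := fun i => ∑ j, ‖N j i‖ ^ 2) (fun _ _ => by positivity)
              (Finset.mem_univ i)
  convert hK.image (f := fun N : Matrix n n ℂ => Nᴴ * N)
    (continuous_id.matrix_conjTranspose.matrix_mul continuous_id) using 1
  ext L
  constructor
  · rintro ⟨hL, hd⟩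
    open scoped MatrixOrder in
    obtain ⟨N, rfl⟩ := CStarAlgebra.nonneg_iff_eq_star_mul_self.mp hL.nonneg
    refine ⟨N, ?_, rfl⟩
    rw [Matrix.star_eq_conjTranspose, htr] at hd
    exact_mod_cast hd
  · rintro ⟨N, hN, rfl⟩
    refine ⟨Matrix.posSemidef_conjTranspose_mul_self N, ?_⟩
    rw [htr, show _ = d from hN]

omit [Fintype n] [DecidableEq n] in
theorem convex_setOf_posSemidef : Convex ℝ {L : Matrix n n ℂ | L.PosSemidef} := by
  intro A hA B hB x y hx hy _
  have h : ∀ (z : ℝ) (C : Matrix n n ℂ), z • C = (z : ℂ) • C := fun z C => by ext; simp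
  change (x • A + y • B).PosSemidef
  rw [h, h]
  exact (Matrix.PosSemidef.smul hA (by simpa using hx)).add
    (Matrix.PosSemidef.smul hB (by simpa using hy))

end Duality

/-! ### Separation over invariant Choi operators. -/

section TwirledDuality

variable {G : Type*} [Group G] [TopologicalSpace G] [IsTopologicalGroup G] [CompactSpace G]
  [MeasurableSpace G] [BorelSpace G]
variable {s t : Type*} [Fintype s] [DecidableEq s] [Fintype t] [DecidableEq t]

/-- A Hermitian operator pairing nonnegatively with all invariant positive operators has a
positive twirl. -/
theorem posSemidef_twirl_of_forall_invariant {U : G →* Matrix.unitaryGroup t ℂ} (hU : Continuous U)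
    {V : G →* Matrix.unitaryGroup s ℂ} (hV : Continuous V) {T : Matrix (t × s) (t × s) ℂ}
    (hT : T.IsHermitian)
    (h : ∀ L : Matrix (t × s) (t × s) ℂ, L.PosSemidef →
      (∀ g, conjKron U V g * L * (conjKron U V g)ᴴ = L) → 0 ≤ (L * T).trace.re) :
    (twirl U V T).PosSemidef := by
  have hH := hT.twirl U V
  refine .of_dotProduct_mulVec_nonneg hH fun x => ?_
  refine Complex.nonneg_iff.mpr ⟨?_, (hH.im_star_dotProduct_mulVec_self x).symm⟩
  -- Self-adjointness moves the twirl onto the rank-one operator `x xᴴ`, whose twirl is an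
  -- admissible `L`.
  have hx : star x ⬝ᵥ (twirl U V T *ᵥ x)
      = (twirl U V (Matrix.vecMulVec x (star x)) * T).trace := by
    rw [← trace_mul_twirl hU hV, Matrix.trace_mul_comm, Matrix.mul_vecMulVec,
      Matrix.trace_vecMulVec, dotProduct_comm]
  rw [hx]
  exact h _ ((Matrix.posSemidef_vecMulVec_self_star x).twirl hU hV)
    (conj_twirl hU hV _)

/-- Conjugation by `Ū` fixes the identity, so only `τ` is averaged. This keeps twirled certificates
in the form demanded by the min-entropy program. -/
theorem exists_twirl_one_kronecker_eq [Nonempty t] {U : G →* Matrix.unitaryGroup t ℂ}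
    (hU : Continuous U) {V : G →* Matrix.unitaryGroup s ℂ} (hV : Continuous V)
    (τ : Matrix s s ℂ) :
    ∃ τ' : Matrix s s ℂ, twirl U V ((1 : Matrix t t ℂ) ⊗ₖ τ) = (1 : Matrix t t ℂ) ⊗ₖ τ' ∧
      τ'.trace = τ.trace := by
  have hconj : ∀ g, conjKron U V g * ((1 : Matrix t t ℂ) ⊗ₖ τ) * (conjKron U V g)ᴴ
      = (1 : Matrix t t ℂ) ⊗ₖ ((V g : Matrix s s ℂ) * τ * (V g : Matrix s s ℂ)ᴴ) := fun g => by
    have hA : ((U g : Matrix t t ℂ).map star) * ((U g : Matrix t t ℂ).map star)ᴴ = 1 := by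
      have h : (U g : Matrix t t ℂ) * (U g : Matrix t t ℂ)ᴴ = 1 :=
        Matrix.mem_unitaryGroup_iff.mp (U g).2
      rw [← Matrix.transpose_one, ← h, Matrix.transpose_mul]
      congr 1
      ext; simp
    rw [conjKron, Matrix.conjTranspose_kronecker, ← Matrix.mul_kronecker_mul,
      ← Matrix.mul_kronecker_mul, mul_one, hA]
  let τ' : Matrix s s ℂ := Matrix.of fun i j =>
    ∫ g, ((V g : Matrix s s ℂ) * τ * (V g : Matrix s s ℂ)ᴴ) i j
      ∂(MeasureTheory.Measure.haarMeasure (⊤ : TopologicalSpace.PositiveCompacts G))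
  have hτ' : twirl U V ((1 : Matrix t t ℂ) ⊗ₖ τ) = (1 : Matrix t t ℂ) ⊗ₖ τ' := by
    ext p q
    simp only [twirl, hconj, τ', Matrix.of_apply, Matrix.kroneckerMap_apply]
    exact MeasureTheory.integral_const_mul _ _
  refine ⟨τ', hτ', ?_⟩
  have h := trace_twirl hU hV ((1 : Matrix t t ℂ) ⊗ₖ τ)
  rw [hτ', Matrix.trace_kronecker, Matrix.trace_kronecker, Matrix.trace_one] at h
  exact mul_left_cancel₀ (by simp) h

variable {ι : Type*} [Fintype ι]

/-- The linear constraints on the Choi operator of a channel mapping `ρ k` to `σ k`. -/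
def choiConstraints (ρ : ι → Matrix s s ℂ) :
    Matrix (t × s) (t × s) ℂ →ₗ[ℝ] Matrix s s ℂ × (ι → Matrix t t ℂ) where
  toFun L := (choiMarginal L, fun k => choiMap L (ρ k))
  map_add' L L' := by
    refine Prod.ext ?_ (funext fun k => ?_)
    · ext; simp [choiMarginal, Finset.sum_add_distrib]
    · ext; simp [choiMap_apply, add_mul, Finset.sum_add_distrib]
  map_smul' z L := by
    refine Prod.ext ?_ (funext fun k => ?_)
    · ext; simp [choiMarginal, Finset.mul_sum]
    · ext; simp [choiMap_apply, mul_assoc, Finset.mul_sum]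

/-- Separation of the constraint point `(1, σ)` from the image of the invariant Choi operators. -/
theorem exists_separating_operators [Nonempty s] {U : G →* Matrix.unitaryGroup t ℂ}
    (hU : Continuous U) {V : G →* Matrix.unitaryGroup s ℂ} (hV : Continuous V)
    {ρ : ι → Matrix s s ℂ} {σ : ι → Matrix t t ℂ} (hρ : ∀ k, (ρ k).IsHermitian)
    (hσ : ∀ k, (σ k).IsHermitian)
    (hnot : ¬ ∃ E : Matrix s s ℂ →ₗ[ℂ] Matrix t t ℂ,
      IsCPTP E ∧ IsCovariant V U E ∧ ∀ k, E (ρ k) = σ k) :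
    ∃ (τ : Matrix s s ℂ) (Y : ι → Matrix t t ℂ), (∀ k, (Y k).IsHermitian) ∧
      (twirl U V ((1 : Matrix t t ℂ) ⊗ₖ τ - ∑ k, Y k ⊗ₖ ρ k)).PosSemidef ∧
      τ.trace.re < (∑ k, ∑ x, ∑ y, Y k x y * σ k x y).re := by
  classical
  have hls : LocallyConvexSpace ℝ (Matrix s s ℂ) :=
    inferInstanceAs (LocallyConvexSpace ℝ (s → s → ℂ))
  have hlt : LocallyConvexSpace ℝ (Matrix t t ℂ) :=
    inferInstanceAs (LocallyConvexSpace ℝ (t → t → ℂ))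
  -- Fixing the trace gives compactness and loses nothing, since a marginal equal to `1` forces
  -- trace `d_B`.
  let S : Set (Matrix (t × s) (t × s) ℂ) :=
    {L | L.PosSemidef ∧ L.trace = (Fintype.card s : ℝ)} ∩
      {L | ∀ g, conjKron U V g * L * (conjKron U V g)ᴴ = L}
  have hScompact : IsCompact S := by
    refine (isCompact_setOf_posSemidef_trace_eq _).inter_right ?_
    simp only [Set.ofPred_forall]
    exact isClosed_iInter fun g => isClosed_eq
      ((continuous_const.matrix_mul continuous_id).matrix_mul continuous_const) continuous_id
  have hSconvex : Convex ℝ S := by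
    intro A hA B hB x y hx hy hxy
    refine ⟨⟨convex_setOf_posSemidef hA.1.1 hB.1.1 hx hy hxy, ?_⟩, fun g => ?_⟩
    · rw [Matrix.trace_add, Matrix.trace_smul, Matrix.trace_smul, hA.1.2, hB.1.2, ← add_smul, hxy,
        one_smul]
    · rw [mul_add, add_mul, Matrix.mul_smul, Matrix.mul_smul, Matrix.smul_mul, Matrix.smul_mul,
        hA.2 g, hB.2 g]
  let Λ := choiConstraints (t := t) ρ
  have hΛ : Continuous Λ := LinearMap.continuous_of_finiteDimensional Λ
  have hp : ((1 : Matrix s s ℂ), σ) ∉ Λ '' S := by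
    rintro ⟨L, hL, hLp⟩
    obtain ⟨h₁, h₂⟩ := Prod.ext_iff.mp hLp
    exact hnot ⟨choiMap L, isCPTP_choiMap hL.1.1 h₁, isCovariant_choiMap hL.2, congr_fun h₂⟩
  obtain ⟨f, u, hfp, hfS⟩ := geometric_hahn_banach_point_closed
    (hSconvex.linear_image Λ) (hScompact.image hΛ).isClosed hp
  obtain ⟨A, hA, hfA⟩ := exists_isHermitian_forall_eq_re_sum
    (f.toLinearMap ∘ₗ LinearMap.inl ℝ (Matrix s s ℂ) (ι → Matrix t t ℂ))
  choose B hB hfB using fun k => exists_isHermitian_forall_eq_re_sum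
    (f.toLinearMap ∘ₗ LinearMap.inr ℝ (Matrix s s ℂ) (ι → Matrix t t ℂ) ∘ₗ
      LinearMap.single ℝ (fun _ : ι => Matrix t t ℂ) k)
  have hf : ∀ (Z : Matrix s s ℂ) (R : ι → Matrix t t ℂ), Z.IsHermitian →
      (∀ k, (R k).IsHermitian) → f (Z, R) = (∑ x, ∑ y, A x y * Z x y).re +
        (∑ k, ∑ x, ∑ y, B k x y * R k x y).re := fun Z R hZ hR => by
    rw [← hfA Z hZ, Complex.re_sum, Finset.sum_congr rfl fun k _ => (hfB k (R k) (hR k)).symm]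
    have e : (Z, R) = LinearMap.inl ℝ (Matrix s s ℂ) (ι → Matrix t t ℂ) Z +
        ∑ k, LinearMap.inr ℝ (Matrix s s ℂ) (ι → Matrix t t ℂ)
          (LinearMap.single ℝ (fun _ : ι => Matrix t t ℂ) k (R k)) := by
      rw [← map_sum]
      have : ∑ k, LinearMap.single ℝ (fun _ : ι => Matrix t t ℂ) k (R k) = R := by
        simp only [LinearMap.single_apply]
        exact Finset.univ_sum_single R
      rw [this]
      simp
    rw [e, map_add, map_sum]
    rfl
  let d : ℝ := Fintype.card s
  have hd : 0 < d := by simp [d, Fintype.card_pos]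
  -- The shift absorbs the threshold `u`: the pairing with `L` becomes `f (Λ L) - (u / d) Tr L`,
  -- which is positive on `S`, while at `(1, σ)` the functional becomes `f (1, σ) - u < 0`.
  let τ : Matrix s s ℂ := A - ((u / d : ℝ) : ℂ) • 1
  have hτ : τ.IsHermitian := by
    refine hA.sub ?_
    rw [Matrix.IsHermitian, Matrix.conjTranspose_smul, Matrix.conjTranspose_one, Complex.star_def,
      Complex.conj_ofReal]
  have hτZ : ∀ Z : Matrix s s ℂ, ∑ x, ∑ y, τ x y * Z x y
      = ∑ x, ∑ y, A x y * Z x y - ((u / d : ℝ) : ℂ) * Z.trace := fun Z => by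
    simp [τ, sub_mul, Finset.sum_sub_distrib, Matrix.one_apply, Matrix.trace, Finset.mul_sum]
  have hT : ((1 : Matrix t t ℂ) ⊗ₖ τ - ∑ k, (-B k) ⊗ₖ ρ k).IsHermitian := by
    refine Matrix.IsHermitian.sub ?_ ?_
    · rw [Matrix.IsHermitian, Matrix.conjTranspose_kronecker, hτ.eq, Matrix.conjTranspose_one]
    · rw [Matrix.IsHermitian, Matrix.conjTranspose_sum]
      refine Finset.sum_congr rfl fun k _ => ?_
      rw [Matrix.conjTranspose_kronecker, (hB k).neg.eq, (hρ k).eq]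
  have hpair : ∀ L : Matrix (t × s) (t × s) ℂ, L.IsHermitian →
      (L * ((1 : Matrix t t ℂ) ⊗ₖ τ - ∑ k, (-B k) ⊗ₖ ρ k)).trace.re
        = f (Λ L) - u / d * L.trace.re := fun L hL => by
    have h := hf (choiMarginal L) (fun k => choiMap L (ρ k)) (isHermitian_choiMarginal hL)
      fun k => isHermitian_choiMap hL (hρ k)
    change f (Λ L) = _ at h
    rw [h, mul_sub, Matrix.trace_sub, ← sum_mul_choiMarginal_apply, hτZ, trace_choiMarginal,
      Finset.mul_sum, Matrix.trace_sum]
    simp only [← sum_mul_choiMap_apply, Matrix.neg_apply, neg_mul, Finset.sum_neg_distrib]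
    simp only [Complex.sub_re, Complex.neg_re, Complex.re_ofReal_mul]
    ring
  refine ⟨τ, fun k => -B k, fun k => (hB k).neg, ?_, ?_⟩
  · refine posSemidef_twirl_of_forall_invariant hU hV hT fun L hL hinv => ?_
    rw [hpair L hL.isHermitian]
    have htr := Complex.nonneg_iff.mp hL.trace_nonneg
    -- Either `L = 0`, or `L` can be rescaled to trace `d` and so moved into `S`.
    rcases htr.1.eq_or_lt with h₀ | h₀
    · have hL₀ : L = 0 := hL.trace_eq_zero_iff.mp (Complex.ext h₀.symm htr.2.symm)
      simp [hL₀]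
    · set z : ℝ := d / L.trace.re with hz
      have hzpos : 0 < z := div_pos hd h₀
      have hmem : z • L ∈ S := by
        refine ⟨⟨?_, ?_⟩, fun g => ?_⟩
        · have : z • L = (z : ℂ) • L := by ext; simp
          rw [this]
          exact hL.smul (by simpa using hzpos.le)
        · have : L.trace = ((L.trace.re : ℝ) : ℂ) := Complex.ext rfl htr.2.symm
          rw [Matrix.trace_smul, this, Complex.real_smul, ← Complex.ofReal_mul, hz,
            div_mul_cancel₀ _ h₀.ne']
        · rw [Matrix.mul_smul, Matrix.smul_mul, hinv g]
      have h := hfS _ ⟨_, hmem, rfl⟩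
      rw [map_smul, map_smul, smul_eq_mul, hz] at h
      have : u / d * L.trace.re < f (Λ L) := by
        rw [div_mul_eq_mul_div, lt_div_iff₀ h₀] at h
        rw [div_mul_eq_mul_div, div_lt_iff₀ hd]
        linarith
      linarith
  · have h := hf 1 σ Matrix.isHermitian_one hσ
    have h₁ := hτZ 1
    have h₂ : ∑ x, ∑ y, τ x y * (1 : Matrix s s ℂ) x y = τ.trace := by
      simp [Matrix.one_apply, Matrix.trace]
    rw [h₂, Matrix.trace_one] at h₁
    rw [h₁]
    simp only [Matrix.neg_apply, neg_mul, Finset.sum_neg_distrib, Complex.sub_re, Complex.neg_re,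
      Complex.re_ofReal_mul, Complex.natCast_re]
    have : u / d * (Fintype.card s : ℝ) = u := div_mul_cancel₀ _ hd.ne'
    linarith

end TwirledDuality

/-! ### From separating operators to states. -/

section FamilyMajorization

variable {ι s t : Type*} [Fintype ι] [Fintype s] [Fintype t] [DecidableEq t] [Nonempty t]

/-- Finitely many Hermitian matrices become states after shifting by multiples of the identity and
a common positive rescaling. -/
theorem exists_isState_eq_smul_add_smul_one {Y : ι → Matrix t t ℂ}
    (hY : ∀ k, (Y k).IsHermitian) :
    ∃ (z : ℝ) (y : ι → ℝ), 0 < z ∧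
      ∀ k, IsState ((z : ℂ) • (Y k + (y k : ℂ) • (1 : Matrix t t ℂ))) := by
  choose r₀ hr₀ using fun k => (hY k).exists_add_smul_one_posSemidef
  have hd : (0 : ℝ) < Fintype.card t := by simp [Fintype.card_pos]
  obtain ⟨M, hM⟩ := Finite.exists_le fun k => Fintype.card t * r₀ k + (Y k).trace.re
  let m := max M 1
  have hm : 0 < m := lt_max_of_lt_right one_pos
  -- Each shift brings the trace to the same value `m`, chosen so large that every shifted matrix is
  -- positive.
  refine ⟨m⁻¹, fun k => (m - (Y k).trace.re) / Fintype.card t, inv_pos.mpr hm, fun k => ⟨?_, ?_⟩⟩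
  · refine (hr₀ k _ ?_).smul (by simpa using hm.le)
    rw [le_div_iff₀ hd]
    linarith [hM k, le_max_left M 1]
  · have h : (Y k).trace = ((Y k).trace.re : ℂ) := by
      refine (Complex.conj_eq_iff_re.mp ?_).symm
      rw [← Complex.star_def, ← Matrix.trace_conjTranspose, (hY k).eq]
    rw [Matrix.trace_smul, Matrix.trace_add, Matrix.trace_smul, Matrix.trace_one, h, smul_eq_mul,
      smul_eq_mul, ← Complex.ofReal_natCast, ← Complex.ofReal_mul, ← Complex.ofReal_add,
      ← Complex.ofReal_mul, div_mul_cancel₀ _ hd.ne', add_sub_cancel, inv_mul_cancel₀ hm.ne',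
      Complex.ofReal_one]

variable {G : Type*} [Group G] [TopologicalSpace G] [IsTopologicalGroup G] [CompactSpace G]
  [MeasurableSpace G] [BorelSpace G]

/-- A criterion for a covariant channel mapping each `ρ k` to `σ k`. -/
theorem exists_covariant_of_forall_le [DecidableEq s] [Nonempty s]
    {U : G →* Matrix.unitaryGroup t ℂ} (hU : Continuous U)
    {V : G →* Matrix.unitaryGroup s ℂ} (hV : Continuous V)
    {ρ : ι → Matrix s s ℂ} {σ : ι → Matrix t t ℂ} (hρ : ∀ k, (ρ k).PosSemidef)
    (hσ : ∀ k, (σ k).IsHermitian) (htr : ∀ k, (ρ k).trace = (σ k).trace)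
    (h : ∀ ω : ι → Matrix t t ℂ, (∀ k, IsState (ω k)) →
      ∀ x ∈ minEntropyValues (twirl U V (∑ k, ω k ⊗ₖ ρ k)),
        (∑ k, ∑ x, ∑ y, ω k x y * σ k x y).re ≤ x) :
    ∃ E : Matrix s s ℂ →ₗ[ℂ] Matrix t t ℂ,
      IsCPTP E ∧ IsCovariant V U E ∧ ∀ k, E (ρ k) = σ k := by
  by_contra hnot
  obtain ⟨τ, Y, hY, hT, hlt⟩ :=
    exists_separating_operators hU hV (fun k => (hρ k).isHermitian) hσ hnot
  obtain ⟨z, y, hz, hω⟩ := exists_isState_eq_smul_add_smul_one hY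
  let ω : ι → Matrix t t ℂ := fun k => (z : ℂ) • (Y k + (y k : ℂ) • (1 : Matrix t t ℂ))
  -- Shifting `Y k` adds `y k • (1 ⊗ ρ k)` to the sum, which `τ` can absorb. The gap only scales by
  -- `z`, because `ρ k` and `σ k` have equal traces.
  let τ₁ : Matrix s s ℂ := (z : ℂ) • (τ + ∑ k, (y k : ℂ) • ρ k)
  obtain ⟨τ₂, hτ₂, hτ₂tr⟩ := exists_twirl_one_kronecker_eq hU hV τ₁
  have hT₁ : (1 : Matrix t t ℂ) ⊗ₖ τ₁ - ∑ k, ω k ⊗ₖ ρ k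
      = (z : ℂ) • ((1 : Matrix t t ℂ) ⊗ₖ τ - ∑ k, Y k ⊗ₖ ρ k) := by
    have hsum : (1 : Matrix t t ℂ) ⊗ₖ (∑ k, (y k : ℂ) • ρ k)
        = ∑ k, (y k : ℂ) • ((1 : Matrix t t ℂ) ⊗ₖ ρ k) := by
      ext p q
      simp only [Matrix.kroneckerMap_apply, Matrix.sum_apply, Matrix.smul_apply, smul_eq_mul,
        Finset.mul_sum, mul_left_comm]
    simp only [τ₁, ω, Matrix.kronecker_smul, Matrix.smul_kronecker, Matrix.kronecker_add,
      Matrix.add_kronecker, ← Finset.smul_sum, Finset.sum_add_distrib, hsum, ← smul_sub]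
    congr 1
    abel
  have hpos : ((1 : Matrix t t ℂ) ⊗ₖ τ₂ - twirl U V (∑ k, ω k ⊗ₖ ρ k)).PosSemidef := by
    rw [← hτ₂, ← twirl_sub hU hV, hT₁, twirl_smul]
    exact hT.smul (by simpa using hz.le)
  -- Separation gives no sign for `τ`; positivity follows from `1 ⊗ τ₂ ≥ Ω ≥ 0` on a diagonal block.
  have hτ₂pos : τ₂.PosSemidef := by
    have hΩ : (twirl U V (∑ k, ω k ⊗ₖ ρ k)).PosSemidef :=
      (Matrix.posSemidef_sum _ fun k _ => (hω k).1.kronecker (hρ k)).twirl hU hV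
    have h₁ := hpos.add hΩ
    rw [sub_add_cancel] at h₁
    let x₀ : t := Classical.arbitrary t
    convert h₁.submatrix fun i => (x₀, i) using 1
    ext; simp
  have hle := h ω hω _ ⟨τ₂, hτ₂pos, hpos, rfl⟩
  have e₁ : τ₂.trace.re = z * (τ.trace.re + (∑ k, (y k : ℂ) * (ρ k).trace).re) := by
    rw [hτ₂tr, Matrix.trace_smul, Matrix.trace_add, Matrix.trace_sum, smul_eq_mul,
      Complex.re_ofReal_mul, Complex.add_re]
    simp only [Matrix.trace_smul, smul_eq_mul]
  have e₂ : ∑ k, ∑ x, ∑ y, ω k x y * σ k x y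
      = (z : ℂ) * (∑ k, ∑ x, ∑ y, Y k x y * σ k x y + ∑ k, (y k : ℂ) * (σ k).trace) := by
    rw [← Finset.sum_add_distrib, Finset.mul_sum]
    refine Finset.sum_congr rfl fun k _ => ?_
    simp only [ω, Matrix.smul_apply, Matrix.add_apply, Matrix.one_apply, smul_eq_mul, mul_ite,
      mul_one, mul_zero, mul_add, add_mul, Finset.sum_add_distrib, ite_mul, zero_mul,
      Finset.sum_ite_eq, Finset.mem_univ, if_true, Matrix.trace, Matrix.diag_apply, Finset.mul_sum,
      mul_assoc]
  rw [e₁, e₂, Complex.re_ofReal_mul, Complex.add_re] at hle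
  simp only [htr] at hle
  have := le_of_mul_le_mul_left hle hz
  linarith

end FamilyMajorization

/-! ### Existence of an informationally complete measurement by polarization. -/

section InfoComplete

/-- Some finite informationally complete measurement exists. -/
theorem exists_infoComplete (a : Type*) [Fintype a] [DecidableEq a] [Nonempty a] :
    ∃ M : a × a × Fin 4 → Matrix a a ℂ, (∀ j, (M j).PosSemidef) ∧ ∑ j, M j = 1 ∧
      Submodule.span ℂ (Set.range M) = ⊤ := by
  let v : a × a × Fin 4 → a → ℂ := fun j =>
    Pi.single j.1 1 + (Complex.I ^ (j.2.2 : ℕ)) • Pi.single j.2.1 1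
  let P : a × a × Fin 4 → Matrix a a ℂ := fun j => Matrix.vecMulVec (v j) (star (v j))
  have hP : ∀ i j k, P (i, j, k) = Matrix.single i i 1 + Matrix.single j j 1
      + (star (Complex.I ^ (k : ℕ))) • Matrix.single i j 1
      + (Complex.I ^ (k : ℕ)) • Matrix.single j i 1 := by
    intro i j k
    have h : (Complex.I ^ (k : ℕ)) * star (Complex.I ^ (k : ℕ)) = 1 := by
      rw [star_pow, ← mul_pow]; simp
    simp only [P, v, star_add, star_smul, Matrix.add_vecMulVec, Matrix.vecMulVec_add,
      Matrix.smul_vecMulVec, Matrix.vecMulVec_smul, Matrix.single_eq_single_vecMulVec_single,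
      Pi.star_single, star_one, smul_smul, smul_add]
    rw [mul_comm, h, one_smul]
    abel
  -- The plain sum over fourth roots of unity cancels the cross terms; the sum weighted by `I ^ k`
  -- in `hspan` isolates one matrix unit.
  have hcol : ∀ i j, ∑ k : Fin 4, P (i, j, k)
      = (4 : ℂ) • (Matrix.single i i 1 + Matrix.single j j 1) := fun i j => by
    rw [Fin.sum_univ_four]
    simp only [hP, Fin.coe_ofNat_eq_mod, pow_zero, pow_one,
      Complex.I_sq, Nat.reduceMod, Complex.I_pow_three, star_neg, star_one, Complex.star_def,
      Complex.conj_I]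
    module
  have hspan : ∀ i j, ∑ k : Fin 4, (Complex.I ^ (k : ℕ)) • P (i, j, k)
      = (4 : ℂ) • Matrix.single i j 1 := fun i j => by
    rw [Fin.sum_univ_four]
    simp only [hP, Fin.coe_ofNat_eq_mod, pow_zero, pow_one,
      Complex.I_sq, Nat.reduceMod, Complex.I_pow_three, star_neg, star_one, Complex.star_def,
      Complex.conj_I, smul_add, smul_smul, mul_neg, neg_mul, Complex.I_mul_I, neg_neg, mul_one]
    module
  let d : ℝ := Fintype.card a
  have hd : 0 < d := by simp [d, Fintype.card_pos]
  have hone : ∑ i : a, Matrix.single i i (1 : ℂ) = 1 := by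
    exact Matrix.sum_single_one
  have hsum : ∑ j, P j = ((8 * d : ℝ) : ℂ) • (1 : Matrix a a ℂ) := by
    simp only [Fintype.sum_prod_type, hcol, ← Finset.smul_sum, Finset.sum_add_distrib, hone,
      Finset.sum_const, Finset.card_univ, ← Nat.cast_smul_eq_nsmul ℂ]
    simp only [d, Complex.ofReal_mul, Complex.ofReal_natCast, Complex.ofReal_ofNat]
    module
  refine ⟨fun j => (((8 * d)⁻¹ : ℝ) : ℂ) • P j, fun j => ?_, ?_, ?_⟩
  · exact (Matrix.posSemidef_vecMulVec_self_star (v j)).smul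
      (Complex.zero_le_real.mpr (by positivity))
  · rw [← Finset.smul_sum, hsum, smul_smul, ← Complex.ofReal_mul, inv_mul_cancel₀ (by positivity),
      Complex.ofReal_one, one_smul]
  · rw [eq_top_iff]
    intro X _
    have hPmem : ∀ j, P j ∈ Submodule.span ℂ
        (Set.range fun j => (((8 * d)⁻¹ : ℝ) : ℂ) • P j) := fun j => by
      have h := Submodule.smul_mem _ ((8 * d : ℝ) : ℂ) (Submodule.subset_span (R := ℂ)
        (Set.mem_range_self (f := fun j => (((8 * d)⁻¹ : ℝ) : ℂ) • P j) j))
      rwa [smul_smul, ← Complex.ofReal_mul, mul_inv_cancel₀ (by positivity), Complex.ofReal_one,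
        one_smul] at h
    rw [Matrix.matrix_eq_sum_single X]
    refine Submodule.sum_mem _ fun i _ => Submodule.sum_mem _ fun j _ => ?_
    have e : Matrix.single i j (X i j) = (X i j / 4) • ((4 : ℂ) • Matrix.single i j 1) := by
      rw [smul_smul, div_mul_cancel₀ _ (by norm_num), Matrix.smul_single, smul_eq_mul, mul_one]
    rw [e, ← hspan]
    exact Submodule.smul_mem _ _ (Submodule.sum_mem _ fun k _ =>
      Submodule.smul_mem _ _ (hPmem _))

end InfoComplete

/-! ### The implications between majorization, entropies and singlet fractions. -/

section CovariantMajorization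

theorem IsState.nonempty {s : Type*} [Fintype s] {ρ : Matrix s s ℂ} (hρ : IsState ρ) :
    Nonempty s := by
  by_contra h
  rw [not_nonempty_iff] at h
  have := hρ.2
  simp [Matrix.trace] at this

theorem IsState.kronecker {s t : Type*} [Fintype s] [Fintype t] [DecidableEq s] [DecidableEq t]
    {η : Matrix t t ℂ} {ρ : Matrix s s ℂ} (hη : IsState η) (hρ : IsState ρ) :
    IsState (η ⊗ₖ ρ) :=
  ⟨hη.1.kronecker hρ.1, by rw [Matrix.trace_kronecker, hη.2, hρ.2, one_mul]⟩

variable {G : Type*} [Group G] [TopologicalSpace G] [IsTopologicalGroup G] [CompactSpace G]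
  [MeasurableSpace G] [BorelSpace G]
variable {a b c : Type*} [Fintype a] [DecidableEq a] [Fintype b] [DecidableEq b]
  [Fintype c] [DecidableEq c]
variable {V : G →* Matrix.unitaryGroup b ℂ} {U : G →* Matrix.unitaryGroup c ℂ}

theorem IsState.twirl {X : Matrix (c × b) (c × b) ℂ} (hX : IsState X) (hU : Continuous U)
    (hV : Continuous V) : IsState (twirl U V X) :=
  ⟨hX.1.twirl hU hV, (trace_twirl hU hV X).trans hX.2⟩

/-- Covariant channels do not decrease the min-entropy of twirled states. -/
theorem IsCovariant.condMinEntropy_twirl_le (hV : Continuous V) (hU : Continuous U)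
    {E : Matrix b b ℂ →ₗ[ℂ] Matrix c c ℂ} (hE : IsCovariant V U E) (hE' : IsCPTP E)
    {Ω : Matrix (c × b) (c × b) ℂ} (hΩ : IsState Ω) (hΩ' : IsState (idTensor E Ω)) :
    condMinEntropy (twirl U V Ω) ≤ condMinEntropy (twirl U U (idTensor E Ω)) := by
  rw [condMinEntropy_le_iff (hΩ.twirl hU hV) (hΩ'.twirl hU hU), hE.twirl_idTensor hV hU]
  exact sInf_minEntropyValues_idTensor_le hE' (hΩ.twirl hU hV).1.isHermitian

omit [DecidableEq b] in
theorem card_mul_expectation_le_of_condMinEntropy_le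
    {Ω : Matrix (c × b) (c × b) ℂ} (hΩ : IsState Ω) {Ω' : Matrix (c × c) (c × c) ℂ}
    (hΩ' : IsState Ω') (h : condMinEntropy Ω ≤ condMinEntropy Ω') :
    (Fintype.card c : ℝ) * expectation (maxEntangled c) Ω' ≤ (2 : ℝ) ^ (-condMinEntropy Ω) := by
  have : Nonempty c := hΩ'.nonempty.map Prod.fst
  rw [two_rpow_neg_condMinEntropy hΩ]
  rw [condMinEntropy_le_iff hΩ hΩ'] at h
  exact (le_csInf (minEntropyValues_nonempty hΩ'.1.isHermitian)
    fun x hx => card_mul_expectation_maxEntangled_le hx).trans h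

theorem CovariantMajorizes.condMinEntropy_le (hV : Continuous V) (hU : Continuous U)
    {ρ : Matrix (a × b) (a × b) ℂ} {σ : Matrix (a × c) (a × c) ℂ} (h : CovariantMajorizes V U ρ σ)
    (hρ : IsState ρ) (hσ : IsState σ) {Φ : Matrix a a ℂ →ₗ[ℂ] Matrix c c ℂ} (hΦ : IsCPTP Φ) :
    condMinEntropy (twirl U V (tensorId Φ ρ)) ≤ condMinEntropy (twirl U U (tensorId Φ σ)) := by
  obtain ⟨E, hE, hcov, rfl⟩ := h
  have hσ' := hΦ.isState_tensorId hσ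
  rw [tensorId_idTensor] at hσ' ⊢
  exact hcov.condMinEntropy_twirl_le hV hU hE (hΦ.isState_tensorId hρ) hσ'

/-- Comparing guessing probabilities with singlet fractions for the measure-and-prepare channels of
one informationally complete measurement suffices for covariant majorization. -/
theorem covariantMajorizes_of_forall_measurePrepare {ι : Type*} [Fintype ι]
    (hV : Continuous V) (hU : Continuous U)
    {ρ : Matrix (a × b) (a × b) ℂ} {σ : Matrix (a × c) (a × c) ℂ} (hρ : IsState ρ)
    (hσ : IsState σ) (hm : marginalFst ρ = marginalFst σ) {M : ι → Matrix a a ℂ}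
    (hM : ∀ j, (M j).PosSemidef) (hM₁ : ∑ j, M j = 1)
    (hspan : Submodule.span ℂ (Set.range M) = ⊤)
    (h : ∀ ω : ι → Matrix c c ℂ, (∀ j, IsState (ω j)) →
      (Fintype.card c : ℝ) * expectation (maxEntangled c)
          (twirl U U (tensorId (measurePrepare M ω) σ))
        ≤ (2 : ℝ) ^ (-condMinEntropy (twirl U V (tensorId (measurePrepare M ω) ρ)))) :
    CovariantMajorizes V U ρ σ := by
  have : Nonempty b := hρ.nonempty.map Prod.snd
  have : Nonempty c := hσ.nonempty.map Prod.snd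
  obtain ⟨E, hE, hcov, hEρ⟩ := exists_covariant_of_forall_le hU hV
    (ρ := fun j => conditioned (M j) ρ) (σ := fun j => conditioned (M j) σ)
    (fun j => posSemidef_conditioned (hM j) hρ.1)
    (fun j => (posSemidef_conditioned (hM j) hσ.1).isHermitian)
    (fun j => by rw [trace_conditioned, trace_conditioned, hm]) fun ω hω x hx => by
      have hΦ := isCPTP_measurePrepare hM hM₁ hω
      have h₁ := h ω hω
      rw [two_rpow_neg_condMinEntropy ((hΦ.isState_tensorId hρ).twirl hU hV),
        card_mul_expectation_maxEntangled, sum_diag_twirl hU, tensorId_measurePrepare,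
        tensorId_measurePrepare] at h₁
      -- With the twirl removed, the scaled singlet fraction is exactly the pairing of the `ω j`
      -- with the conditioned operators of `σ`.
      refine le_trans (le_of_eq ?_) (h₁.trans (csInf_le (bddBelow_minEntropyValues _) hx))
      simp only [Matrix.sum_apply, Matrix.kroneckerMap_apply]
      congr 1
      rw [Finset.sum_comm]
      refine Finset.sum_congr rfl fun x _ => ?_
      rw [Finset.sum_comm]
  refine ⟨E, hE, hcov, eq_of_conditioned_eq hspan fun j => ?_⟩
  rw [conditioned_idTensor, hEρ]

end CovariantMajorization

end

/-! ### The two characterizations assembled. -/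

theorem mainTheorem4
    {G : Type*} [Group G] [TopologicalSpace G] [IsTopologicalGroup G] [CompactSpace G]
    [MeasurableSpace G] [BorelSpace G]
    {a b c : Type*} [Fintype a] [DecidableEq a] [Fintype b] [DecidableEq b]
    [Fintype c] [DecidableEq c]
    (V : G →* Matrix.unitaryGroup b ℂ) (hV : Continuous V)
    (U : G →* Matrix.unitaryGroup c ℂ) (hU : Continuous U) :
    -- the characterization of covariant quantum majorization
    (∀ (ρ : Matrix (a × b) (a × b) ℂ) (σ : Matrix (a × c) (a × c) ℂ),
      IsState ρ → IsState σ → marginalFst ρ = marginalFst σ →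
        (CovariantMajorizes V U ρ σ ↔
          ∀ Φ : Matrix a a ℂ →ₗ[ℂ] Matrix c c ℂ, IsCPTP Φ →
            condMinEntropy (twirl U V (tensorId Φ ρ))
              ≤ condMinEntropy (twirl U U (tensorId Φ σ)))
        ∧ ∀ M : Fin (Fintype.card a ^ 2) → Matrix a a ℂ, IsInfoCompletePOVM M →
          [ CovariantMajorizes V U ρ σ,
            ∀ ω : Fin (Fintype.card a ^ 2) → Matrix c c ℂ, (∀ j, IsState (ω j)) →
              condMinEntropy (twirl U V (tensorId (measurePrepare M ω) ρ))
                ≤ condMinEntropy (twirl U U (tensorId (measurePrepare M ω) σ)),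
            ∀ ω : Fin (Fintype.card a ^ 2) → Matrix c c ℂ, (∀ j, IsState (ω j)) →
              (Fintype.card c : ℝ) * expectation (maxEntangled c)
                  (twirl U U (tensorId (measurePrepare M ω) σ))
                ≤ (2 : ℝ) ^ (-condMinEntropy (twirl U V (tensorId (measurePrepare M ω) ρ)))
          ].TFAE)
    -- the complete set of asymmetry monotones
    ∧ (∀ (ρ : Matrix b b ℂ) (σ : Matrix c c ℂ), IsState ρ → IsState σ →
        ((∃ E : Matrix b b ℂ →ₗ[ℂ] Matrix c c ℂ, IsCPTP E ∧ IsCovariant V U E ∧ E ρ = σ) ↔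
          ∀ η : Matrix c c ℂ, IsState η →
            condMinEntropy (twirl U V (η ⊗ₖ ρ)) ≤ condMinEntropy (twirl U U (η ⊗ₖ σ)))) := by
  refine ⟨fun ρ σ hρ hσ hm => ⟨⟨fun h Φ hΦ => h.condMinEntropy_le hV hU hρ hσ hΦ, fun h => ?_⟩,
    fun M hM => ?_⟩, fun ρ σ hρ hσ => ⟨?_, fun h => ?_⟩⟩
  · have : Nonempty a := hρ.nonempty.map Prod.fst
    -- No POVM is given here, so one is chosen; its `4 d_A²` outcomes are harmless because the
    -- criterion accepts any finite index type.
    obtain ⟨M, hM, hM₁, hspan⟩ := exists_infoComplete a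
    refine covariantMajorizes_of_forall_measurePrepare hV hU hρ hσ hm hM hM₁ hspan fun ω hω => ?_
    have hΦ := isCPTP_measurePrepare hM hM₁ hω
    exact card_mul_expectation_le_of_condMinEntropy_le ((hΦ.isState_tensorId hρ).twirl hU hV)
      ((hΦ.isState_tensorId hσ).twirl hU hU) (h _ hΦ)
  · have hΦ : ∀ ω : Fin (Fintype.card a ^ 2) → Matrix c c ℂ, (∀ j, IsState (ω j)) →
        IsCPTP (measurePrepare M ω) := fun ω hω =>
      isCPTP_measurePrepare hM.posSemidef hM.sum_eq_one hω
    tfae_have 1 → 2 := fun h ω hω => h.condMinEntropy_le hV hU hρ hσ (hΦ ω hω)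
    tfae_have 2 → 3 := fun h ω hω => card_mul_expectation_le_of_condMinEntropy_le
      (((hΦ ω hω).isState_tensorId hρ).twirl hU hV)
      (((hΦ ω hω).isState_tensorId hσ).twirl hU hU) (h ω hω)
    tfae_have 3 → 1 := covariantMajorizes_of_forall_measurePrepare hV hU hρ hσ hm
      hM.posSemidef hM.sum_eq_one hM.span_eq_top
    tfae_finish
  · rintro ⟨E, hE, hcov, rfl⟩ η hη
    have h := hη.kronecker hσ
    rw [← idTensor_kronecker] at h ⊢
    exact hcov.condMinEntropy_twirl_le hV hU hE (hη.kronecker hρ) h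
  · have : Nonempty b := hρ.nonempty
    have : Nonempty c := hσ.nonempty
    -- A family indexed by `Unit` needs a single prepared state, which plays the role of `η`.
    obtain ⟨E, hE, hcov, hEρ⟩ := exists_covariant_of_forall_le hU hV
      (ρ := fun _ : Unit => ρ) (σ := fun _ : Unit => σ) (fun _ => hρ.1)
      (fun _ => hσ.1.isHermitian) (fun _ => hρ.2.trans hσ.2.symm) fun ω hω x hx => by
        have hη := hω ()
        have h₁ := card_mul_expectation_le_of_condMinEntropy_le
          ((hη.kronecker hρ).twirl hU hV) ((hη.kronecker hσ).twirl hU hU) (h _ hη)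
        rw [two_rpow_neg_condMinEntropy ((hη.kronecker hρ).twirl hU hV),
          card_mul_expectation_maxEntangled, sum_diag_twirl hU] at h₁
        rw [Fintype.sum_unique] at hx ⊢
        exact h₁.trans (csInf_le (bddBelow_minEntropyValues _) hx)
    exact ⟨E, hE, hcov, hEρ ()⟩
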